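/- Let $M,S$ be positive integers with $M$ even and $M\ge 4S$, and put $L=M/2$. Let $\mathbb T=\mathbb R/\mathbb Z$ with $|t|_{\mathbb T}=\min_{n\in\mathbb Z}|t-n|$. Let $\mu=\sum_{j=1}^S x_j\delta_{\omega_j}$ with $x_j\in\mathbb C\setminus\{0\}$ and $\omega_j\in\mathbb T$, let $x_{\min}=\min_j|x_j|$ and $\Omega=\{\omega_j\}_{j=1}^S$, and suppose that $\Delta:=\min_{j\ne k}|\omega_j-\omega_k|_{\mathbb T}\ge C/L$ for some $C>2$ (no condition on $\mu$ if $S=1$). For $y\in\mathbb C^{M+1}$ let $\mathcal H(y)=(y_{i+j})_{0\le i\le L,\,0\le j\le M-L}$ be its Hankel matrix, and let $\|\cdot\|_2$ be the spectral norm. Let $y=y^0+\eta$, where $y^0_k=\sum_{j=1}^S x_je^{-2\pi i k\omega_j}$ for $0\le k\le M$, and where $\eta\in\mathbb C^{M+1}$ satisfies $$\|\mathcal H(\eta)\|_2\le \frac{x_{\min}L}{4\sqrt{2S}}\,\frac{C-1}{C}\,\sqrt{1-\frac{C}{C-1}\frac SL}.$$ The ESPRIT algorithm with input $(y,S,L)$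 works as follows. It computes a singular value decomposition of $\mathcal H(y)$, with singular values in decreasing order, and lets $\hat U\in\mathbb C^{(L+1)\times S}$ consist of the first $S$ left singular vectors. With $\hat U_0$ and $\hat U_1$ the first and the last $L$ rows of $\hat U$, it computes the eigenvalues $\hat\lambda_1,\dots,\hat\lambda_S$ (with algebraic multiplicity) of $\hat U_0^{\dagger}\hat U_1$, where $\dagger$ denotes the Moore–Penrose pseudoinverse. It outputs $\hat\Omega=\{\hat\omega_j\}_{j=1}^S$ with $\hat\omega_j=-\arg(\hat\lambda_j)/(2\pi)\in\mathbb T$ (where $\arg 0=0$). Then ESPRIT has an output and, whatever choices are made in the decomposition, every output $\hat\Omega$ satisfies $$\mathrm{md}(\Omega,\hat\Omega):=\min_{\psi}\max_{j}|\hat\omega_{\psi(j)}-\omega_j|_{\mathbb T}\le \frac{20S^2}{x_{\min}}\,\frac{\sqrt{L+1}}{L^{3/2}}\left(\frac{C}{C-1}\right)^{3/2}\left(1-\frac{C}{C-1}\frac SL\right)^{-1}\|\mathcal H(\eta)\|_2,$$ where $\psi$ runs over the permutations of $\{1,\dots,S\}$. In particular, there is a constant $K$ that depends only on $S$, $C$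 and $x_{\min}$ such that $\mathrm{md}(\Omega,\hat\Omega)\le K\,\|\mathcal H(\eta)\|_2/M$. -/

import Mathlib

noncomputable section

namespace Esprit

/-- The minimum separation `min_{j ≠ k} |ω_j - ω_k|_𝕋` of a family of points of the torus
`𝕋 = ℝ/ℤ`, whose metric is `|a - b|_𝕋 = min_{n ∈ ℤ} |a - b - n|`. It takes values in `[0, ∞]`, so
that the minimum over no pairs (a single point) is `∞`. It is positive only if the points are
pairwise distinct. -/
def minSep {S : ℕ} (ω : Fin S → UnitAddCircle) : ENNReal :=
  ⨅ (j : Fin S) (k : Fin S) (_ : j ≠ k), edist (ω j) (ω k)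

/-- The smallest modulus `x_min = min_j |x_j|` of the amplitudes (used for `S ≥ 1` only). -/
def ampMin {S : ℕ} (x : Fin S → ℂ) : ℝ :=
  ⨅ j : Fin S, ‖x j‖

/-- The Fourier coefficients `μ̂(k) = ∑_j x_j e^{-2πi k ω_j}`, `k = 0, …, M`, of the discrete
measure `μ = ∑_j x_j δ_{ω_j}`. -/
def fourierData (M : ℕ) {S : ℕ} (x : Fin S → ℂ) (ω : Fin S → UnitAddCircle) :
    Fin (M + 1) → ℂ :=
  fun k => ∑ j : Fin S, x j * fourier (-(k : ℤ)) (ω j)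

/-- The `(L+1) × (M-L+1)` Hankel matrix, with entries `y_{i+j}`, of a vector `y ∈ ℂ^{M+1}`. -/
def hankel {M L : ℕ} (hLM : L ≤ M) (y : Fin (M + 1) → ℂ) :
    Matrix (Fin (L + 1)) (Fin (M - L + 1)) ℂ :=
  Matrix.of fun i j => y ⟨(i : ℕ) + (j : ℕ), by omega⟩

open scoped Matrix.Norms.L2Operator in
/-- The spectral norm of a complex matrix: its operator norm for the Euclidean norms. -/
def spectralNorm {m n : ℕ} (A : Matrix (Fin m) (Fin n) ℂ) : ℝ :=
  ‖A‖

/-- The rectangular diagonal `m × n` matrix with diagonal entries `σ 0, σ 1, …`. -/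
def rectDiagonal (m n : ℕ) (σ : ℕ → ℝ) : Matrix (Fin m) (Fin n) ℂ :=
  Matrix.of fun i j => if (i : ℕ) = (j : ℕ) then ((σ i : ℝ) : ℂ) else 0

/-- `A = W Σ V^*` is a (full) singular value decomposition: `W`, `V` are unitary and `Σ` is
rectangular diagonal with nonnegative decreasing diagonal entries. -/
structure IsSVD {m n : ℕ} (A : Matrix (Fin m) (Fin n) ℂ) (W : Matrix (Fin m) (Fin m) ℂ)
    (σ : ℕ → ℝ) (V : Matrix (Fin n) (Fin n) ℂ) : Prop where
  left_unitary : W ∈ Matrix.unitaryGroup (Fin m) ℂ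
  right_unitary : V ∈ Matrix.unitaryGroup (Fin n) ℂ
  antitone : Antitone σ
  nonneg : ∀ k, 0 ≤ σ k
  eq_mul : A = W * rectDiagonal m n σ * V.conjTranspose

/-- `B` is the Moore–Penrose pseudoinverse `A^†` of `A` (the four Penrose equations). -/
structure IsPinv {m n : ℕ} (A : Matrix (Fin m) (Fin n) ℂ) (B : Matrix (Fin n) (Fin m) ℂ) :
    Prop where
  mul_mul_left : A * B * A = A
  mul_mul_right : B * A * B = B
  left_hermitian : (A * B).IsHermitian
  right_hermitian : (B * A).IsHermitian

/-- `lam` lists the eigenvalues of the square matrix `A` with algebraic multiplicity. -/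
def IsEigenvalueList {S : ℕ} (A : Matrix (Fin S) (Fin S) ℂ) (lam : Fin S → ℂ) : Prop :=
  A.charpoly = ∏ j : Fin S, (Polynomial.X - Polynomial.C (lam j))

/-- The first `S` columns of a matrix. -/
def firstCols {m n S : ℕ} (h : S ≤ n) (W : Matrix (Fin m) (Fin n) ℂ) :
    Matrix (Fin m) (Fin S) ℂ :=
  W.submatrix id (Fin.castLE h)

/-- The first `L` rows of a matrix with `L + 1` rows. -/
def dropLastRow {L S : ℕ} (U : Matrix (Fin (L + 1)) (Fin S) ℂ) : Matrix (Fin L) (Fin S) ℂ :=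
  U.submatrix Fin.castSucc id

/-- The last `L` rows of a matrix with `L + 1` rows. -/
def dropFirstRow {L S : ℕ} (U : Matrix (Fin (L + 1)) (Fin S) ℂ) : Matrix (Fin L) (Fin S) ℂ :=
  U.submatrix Fin.succ id

/-- `ωhat` is an output of the ESPRIT algorithm with input `y ∈ ℂ^{M+1}`, sparsity `S` and
parameter `L`: for some singular value decomposition of the Hankel matrix of `y`, with leading `S`
left singular vectors `Û` (whose first and last `L` rows are `Û₀` and `Û₁`), and some listing
`lam` of the eigenvalues of `Ψ̂ = Û₀^† Û₁`, one has `ωhat_j = -arg(lam_j)/(2π)` in `ℝ/ℤ`. -/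
def IsOutput {M L S : ℕ} (hSL : S ≤ L) (hLM : L ≤ M) (y : Fin (M + 1) → ℂ)
    (ωhat : Fin S → UnitAddCircle) : Prop :=
  ∃ (W : Matrix (Fin (L + 1)) (Fin (L + 1)) ℂ) (σ : ℕ → ℝ)
    (V : Matrix (Fin (M - L + 1)) (Fin (M - L + 1)) ℂ)
    (B : Matrix (Fin S) (Fin L) ℂ) (lam : Fin S → ℂ),
    IsSVD (hankel hLM y) W σ V ∧
    IsPinv (dropLastRow (firstCols (Nat.le_succ_of_le hSL) W)) B ∧
    IsEigenvalueList (B * dropFirstRow (firstCols (Nat.le_succ_of_le hSL) W)) lam ∧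
    ∀ j, ωhat j = ((-(lam j).arg / (2 * Real.pi) : ℝ) : UnitAddCircle)

/-- The matching distance `min_ψ max_j |ωhat_{ψ(j)} - ω_j|_𝕋`, over the permutations `ψ` of the
`S` indices. -/
def matchingDist {S : ℕ} (ω ωhat : Fin S → UnitAddCircle) : ℝ :=
  ⨅ ψ : Equiv.Perm (Fin S), ⨆ j : Fin S, dist (ωhat (ψ j)) (ω j)

end Esprit

end

noncomputable section

/-! ### The cosecant kernel and its eigenvalues. -/

namespace Esprit

open Finset ComplexConjugate

/-! The noiseless Hankel matrix factors as `Φ T`, with `Φ` the Vandermonde matrix of the nodes and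
`T` the diagonal matrix of amplitudes times a transposed Vandermonde matrix. Shifting the rows of
`Φ` by one multiplies it on the right by `D = diag(e^{-2πi ω_j})`. Hence for an orthonormal basis
`U` of the range of `Φ` the matrix `U₀† U₁` is similar to `D`, provided `Φ₀` is injective, and the
arguments of its eigenvalues are the nodes. The proof makes this quantitative under noise of
spectral norm `ε`.

Conditioning: for `δ`-separated nodes the large sieve with its lower bound
(`Separated.abs_sum_norm_sq_sub_le`) gives `‖Φ v‖² ≥ (L + 1 - δ⁻¹) ‖v‖²`. It follows from the
Montgomery–Vaughan form of Hilbert's inequality, with constant `δ⁻¹`, which rests on the eigenvector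
computation in `Separated.eigenvalue_sq_le`. Deleting one row of `Φ` costs at most `S ‖v‖²`.

Subspace: `Φ T` has rank at most `S`, so the first discarded singular value of the noisy matrix is
at most `ε`. Projecting `Φ T` off the computed space therefore leaves at most `2ε`. Cancelling `T`
gives `Φ = U P + R` with `R` small; no spectral gap theorem is needed.

Eigenvalues: the shift relation yields the exact identity `P⁻¹ (U₀† U₁) P = D + F`, with `F` linear
in `R`. A continuity argument (`exists_perm_norm_sub_le`) pairs the eigenvalues of `D + F` with the
entries of `D` within `(2S - 1) ‖F‖`, and an elementary estimate passes to arguments. -/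

theorem one_add_two_cos_mul_sq_le {θ : ℝ} (h0 : 0 ≤ θ) (h1 : θ ≤ 2) :
    (1 + 2 * Real.cos θ) * θ ^ 2 ≤ 3 * Real.sin θ ^ 2 := by
  have hs := Real.sin_ge_sub_cube h0
  have hs2 := Real.sin_ge_sub_cube (x := θ / 2) (by linarith)
  have hθ2 : θ ^ 2 ≤ 4 := by nlinarith
  -- The Taylor bounds used for sine and cosine turn both sides into the same polynomial `3θ² - θ⁴ +
  -- θ⁶/12`.
  have e1 : (θ - θ ^ 3 / 6) ^ 2 ≤ Real.sin θ ^ 2 := by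
    refine pow_le_pow_left₀ ?_ hs 2
    nlinarith [mul_nonneg h0 (by linarith : 0 ≤ 4 - θ ^ 2)]
  have e2 : (θ / 2 - (θ / 2) ^ 3 / 6) ^ 2 ≤ Real.sin (θ / 2) ^ 2 := by
    refine pow_le_pow_left₀ ?_ hs2 2
    nlinarith [mul_nonneg h0 (by linarith : 0 ≤ 4 - θ ^ 2)]
  have e3 : Real.cos θ = 1 - 2 * Real.sin (θ / 2) ^ 2 := by
    have h := Real.cos_two_mul (θ / 2)
    rw [show 2 * (θ / 2) = θ by ring] at h
    nlinarith [Real.sin_sq_add_cos_sq (θ / 2)]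
  have e4 : Real.cos θ ≤ 1 - θ ^ 2 / 2 + θ ^ 4 / 24 := by
    rw [e3]; nlinarith [pow_nonneg h0 6]
  nlinarith [mul_le_mul_of_nonneg_right e4 (sq_nonneg θ)]

theorem abs_sin_pi_mul (x : ℝ) : |Real.sin (Real.pi * x)| =
    Real.sin (Real.pi * ‖(x : UnitAddCircle)‖) := by
  have hb := AddCircle.norm_le_half_period (1 : ℝ) (x := (x : UnitAddCircle)) one_ne_zero
  have hn := norm_nonneg (x : UnitAddCircle)
  rw [abs_one] at hb
  have h0 : 0 ≤ Real.sin (Real.pi * ‖(x : UnitAddCircle)‖) :=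
    Real.sin_nonneg_of_nonneg_of_le_pi (by positivity) (by nlinarith [Real.pi_pos])
  rw [← abs_of_nonneg h0, UnitAddCircle.norm_eq]
  have : Real.pi * x = Real.pi * (x - round x) + (round x : ℤ) * Real.pi := by ring
  rw [this, Real.sin_add_int_mul_pi, abs_mul, abs_zpow, abs_neg, abs_one, one_zpow, one_mul]
  rcases abs_choice (x - round x) with h | h <;> rw [h]
  rw [mul_neg, Real.sin_neg, abs_neg]

theorem abs_cos_pi_mul (x : ℝ) : |Real.cos (Real.pi * x)| =
    Real.cos (Real.pi * ‖(x : UnitAddCircle)‖) := by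
  have hb := AddCircle.norm_le_half_period (1 : ℝ) (x := (x : UnitAddCircle)) one_ne_zero
  have hn := norm_nonneg (x : UnitAddCircle)
  rw [abs_one] at hb
  have h0 : 0 ≤ Real.cos (Real.pi * ‖(x : UnitAddCircle)‖) :=
    Real.cos_nonneg_of_neg_pi_div_two_le_of_le (by nlinarith [Real.pi_pos])
      (by nlinarith [Real.pi_pos])
  rw [← abs_of_nonneg h0, UnitAddCircle.norm_eq]
  have : Real.pi * x = Real.pi * (x - round x) + (round x : ℤ) * Real.pi := by ring
  rw [this, Real.cos_add_int_mul_pi, abs_mul, abs_zpow, abs_neg, abs_one, one_zpow, one_mul]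
  rcases abs_choice (x - round x) with h | h <;> rw [h]
  rw [mul_neg, Real.cos_neg]

theorem sin_pi_mul_ne_zero {x : ℝ} (hx : 0 < ‖(x : UnitAddCircle)‖) :
    Real.sin (Real.pi * x) ≠ 0 := by
  have hb := AddCircle.norm_le_half_period (1 : ℝ) (x := (x : UnitAddCircle)) one_ne_zero
  rw [abs_one] at hb
  rw [← abs_pos, abs_sin_pi_mul]
  exact Real.sin_pos_of_pos_of_lt_pi (by positivity) (by nlinarith [Real.pi_pos])

/-- The combination on the left is what survives in the eigenvalue estimate. The constant `3/π²`
cancels against the `π²/3` of `sum_inv_sq_le`, leaving exactly `1/δ²`. -/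
theorem csc_sq_add_le {x : ℝ} (hx : 0 < ‖(x : UnitAddCircle)‖) :
    (Real.sin (Real.pi * x))⁻¹ ^ 2 + 2 * |(Real.sin (Real.pi * x))⁻¹ *
      (Real.cos (Real.pi * x) / Real.sin (Real.pi * x))| ≤
    3 / (Real.pi ^ 2 * ‖(x : UnitAddCircle)‖ ^ 2) := by
  have hs := sin_pi_mul_ne_zero hx
  have hb := AddCircle.norm_le_half_period (1 : ℝ) (x := (x : UnitAddCircle)) one_ne_zero
  rw [abs_one] at hb
  have key := one_add_two_cos_mul_sq_le (θ := Real.pi * ‖(x : UnitAddCircle)‖) (by positivity)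
    (by nlinarith [Real.pi_lt_four, Real.pi_pos])
  rw [← abs_cos_pi_mul, ← abs_sin_pi_mul] at key
  have hs' : 0 < |Real.sin (Real.pi * x)| := abs_pos.2 hs
  have : (Real.sin (Real.pi * x))⁻¹ ^ 2 + 2 * |(Real.sin (Real.pi * x))⁻¹ *
      (Real.cos (Real.pi * x) / Real.sin (Real.pi * x))| =
      (1 + 2 * |Real.cos (Real.pi * x)|) / |Real.sin (Real.pi * x)| ^ 2 := by
    rw [← sq_abs (Real.sin (Real.pi * x))⁻¹, abs_mul, abs_div, abs_inv]
    field_simp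
  rw [this, div_le_div_iff₀ (by positivity) (by positivity)]
  linarith

/-- The floors of `y r / δ` are distinct positive integers, so the sum is dominated by `ζ(2)/δ²`. -/
theorem sum_inv_sq_le_of_pos {ι : Type*} (T : Finset ι) (y : ι → ℝ) {δ : ℝ} (hδ : 0 < δ)
    (h1 : ∀ r ∈ T, δ ≤ y r) (h2 : ∀ r ∈ T, ∀ s ∈ T, r ≠ s → δ ≤ |y r - y s|) :
    ∑ r ∈ T, 1 / y r ^ 2 ≤ Real.pi ^ 2 / (6 * δ ^ 2) := by
  classical
  set k : ι → ℕ := fun r => ⌊y r / δ⌋₊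
  have hk1 : ∀ r ∈ T, 1 ≤ k r := fun r hr =>
    Nat.le_floor (by rw [Nat.cast_one]; exact (one_le_div hδ).2 (h1 r hr))
  have hkle : ∀ r ∈ T, (k r : ℝ) * δ ≤ y r := fun r hr =>
    (le_div_iff₀ hδ).1 (Nat.floor_le (div_nonneg (hδ.le.trans (h1 r hr)) hδ.le))
  have hklt : ∀ r, y r < (k r + 1 : ℝ) * δ := fun r => (div_lt_iff₀ hδ).1 (Nat.lt_floor_add_one _)
  have hinj : Set.InjOn k T := by
    intro r hr s hs hrs
    by_contra hne
    have h := h2 r hr s hs hne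
    have a1 := hkle r hr
    have a2 := hkle s hs
    have a3 := hklt r
    have a4 := hklt s
    rw [hrs] at a1 a3
    rcases abs_cases (y r - y s) with ⟨e, -⟩ | ⟨e, -⟩ <;> rw [e] at h <;> nlinarith
  calc ∑ r ∈ T, 1 / y r ^ 2 ≤ ∑ r ∈ T, (1 / δ ^ 2) * (1 / (k r : ℝ) ^ 2) := by
        refine sum_le_sum fun r hr => ?_
        have : (0 : ℝ) < k r := by exact_mod_cast hk1 r hr
        rw [one_div_mul_one_div, ← mul_pow, mul_comm δ]
        exact one_div_le_one_div_of_le (by positivity)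
          (pow_le_pow_left₀ (by positivity) (hkle r hr) 2)
    _ = (1 / δ ^ 2) * ∑ n ∈ T.image k, 1 / (n : ℝ) ^ 2 := by
        rw [← mul_sum, sum_image hinj]
    _ ≤ (1 / δ ^ 2) * (Real.pi ^ 2 / 6) := by
        gcongr
        exact sum_le_hasSum _ (fun _ _ => by positivity) hasSum_zeta_two
    _ = _ := by field_simp

theorem sum_inv_sq_le {ι : Type*} (T : Finset ι) (y : ι → ℝ) {δ : ℝ} (hδ : 0 < δ)
    (h1 : ∀ r ∈ T, δ ≤ |y r|) (h2 : ∀ r ∈ T, ∀ s ∈ T, r ≠ s → δ ≤ |y r - y s|) :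
    ∑ r ∈ T, 1 / y r ^ 2 ≤ Real.pi ^ 2 / (3 * δ ^ 2) := by
  classical
  rw [← sum_filter_add_sum_filter_not T (fun r => 0 ≤ y r)]
  have e1 := sum_inv_sq_le_of_pos (T.filter fun r => 0 ≤ y r) y hδ
    (fun r hr => by
      rw [mem_filter] at hr
      simpa [abs_of_nonneg hr.2] using h1 r hr.1)
    (fun r hr s hs => h2 r (mem_filter.1 hr).1 s (mem_filter.1 hs).1)
  have e2 := sum_inv_sq_le_of_pos (T.filter fun r => ¬ 0 ≤ y r) (fun r => -y r) hδ
    (fun r hr => by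
      rw [mem_filter, not_le] at hr
      simpa [abs_of_neg hr.2] using h1 r hr.1)
    (fun r hr s hs hne => by
      rw [← neg_sub', abs_neg]
      exact h2 r (mem_filter.1 hr).1 s (mem_filter.1 hs).1 hne)
  simp only [neg_sq] at e2
  have : Real.pi ^ 2 / (3 * δ ^ 2) = Real.pi ^ 2 / (6 * δ ^ 2) + Real.pi ^ 2 / (6 * δ ^ 2) := by
    field_simp; norm_num
  linarith

/-- The antisymmetric kernel `csc π(w r - w s)`, with zero diagonal. -/
def cscKernel {ι : Type*} (w : ι → ℝ) (r s : ι) : ℝ := (Real.sin (Real.pi * (w r - w s)))⁻¹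

/-- The antisymmetric kernel `cot π(w r - w s)`, with zero diagonal. -/
def cotKernel {ι : Type*} (w : ι → ℝ) (r s : ι) : ℝ :=
  Real.cos (Real.pi * (w r - w s)) / Real.sin (Real.pi * (w r - w s))

/-- The points `w r` are `δ`-separated modulo one. -/
def Separated {ι : Type*} (δ : ℝ) (w : ι → ℝ) : Prop :=
  ∀ r s, r ≠ s → δ ≤ ‖((w r - w s : ℝ) : UnitAddCircle)‖

theorem cscKernel_self {ι : Type*} (w : ι → ℝ) (r : ι) : cscKernel w r r = 0 := by
  simp [cscKernel]

theorem cotKernel_self {ι : Type*} (w : ι → ℝ) (r : ι) : cotKernel w r r = 0 := by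
  simp [cotKernel]

theorem cscKernel_swap {ι : Type*} (w : ι → ℝ) (r s : ι) :
    cscKernel w s r = -cscKernel w r s := by
  rw [cscKernel, cscKernel, ← inv_neg, ← Real.sin_neg]; congr 2; ring

theorem cotKernel_swap {ι : Type*} (w : ι → ℝ) (r s : ι) :
    cotKernel w s r = -cotKernel w r s := by
  rw [cotKernel, cotKernel, ← div_neg, ← Real.sin_neg, ← Real.cos_neg]; congr 2 <;> ring

theorem Separated.sin_ne_zero {ι : Type*} {δ : ℝ} {w : ι → ℝ} (hδ : 0 < δ)
    (hw : Separated δ w) {r s : ι} (h : r ≠ s) : Real.sin (Real.pi * (w r - w s)) ≠ 0 :=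
  sin_pi_mul_ne_zero (hδ.trans_le (hw r s h))

/-- For distinct indices this is `cot α - cot β = sin (β - α) / (sin α sin β)`. The conditional
terms correct for the zero values of both kernels on the diagonal. -/
theorem cscKernel_mul_cscKernel {ι : Type*} [DecidableEq ι] {δ : ℝ} {w : ι → ℝ} (hδ : 0 < δ)
    (hw : Separated δ w) (r s t : ι) :
    cscKernel w r s * cscKernel w r t = cscKernel w s t * (cotKernel w r s - cotKernel w r t) +
      (if r = s then cscKernel w s t * cotKernel w s t else 0) +
      (if r = t then cscKernel w s t * cotKernel w s t else 0) +
      if s = t then cscKernel w r s ^ 2 else 0 := by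
  rcases eq_or_ne s t with rfl | hst
  · simp [cscKernel_self, sq]
  rcases eq_or_ne r s with rfl | hrs
  · simp [hst, cscKernel_self, cotKernel_self]
  rcases eq_or_ne r t with rfl | hrt
  · simp [hrs, hst, cscKernel_self, cotKernel_self, cotKernel_swap w r s]
  · have h1 := hw.sin_ne_zero hδ hst
    have h2 := hw.sin_ne_zero hδ hrs
    have h3 := hw.sin_ne_zero hδ hrt
    simp only [hrs, hrt, hst, if_false, add_zero]
    have h : Real.sin (Real.pi * (w s - w t)) =
        Real.sin (Real.pi * (w r - w t)) * Real.cos (Real.pi * (w r - w s)) -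
        Real.cos (Real.pi * (w r - w t)) * Real.sin (Real.pi * (w r - w s)) := by
      rw [← Real.sin_sub]; congr 1; ring
    simp only [cscKernel, cotKernel]
    field_simp
    rw [h]; ring

theorem sum_cscKernel_mul_cscKernel {ι : Type*} [Fintype ι] [DecidableEq ι] {δ : ℝ} {w : ι → ℝ}
    (hδ : 0 < δ) (hw : Separated δ w) (s t : ι) :
    ∑ r, cscKernel w r s * cscKernel w r t =
      cscKernel w s t * (∑ r, cotKernel w r s - ∑ r, cotKernel w r t) +
      2 * (cscKernel w s t * cotKernel w s t) +
      if s = t then ∑ r, cscKernel w r s ^ 2 else 0 := by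
  rw [sum_congr rfl fun r _ => cscKernel_mul_cscKernel hδ hw r s t]
  simp only [sum_add_distrib, ← mul_sum, sum_sub_distrib, sum_ite_eq', mem_univ, if_true]
  split_ifs <;> simp <;> ring

theorem Separated.sum_csc_sq_add_le {ι : Type*} [Fintype ι] [DecidableEq ι] {δ : ℝ} {w : ι → ℝ}
    (hδ : 0 < δ) (hw : Separated δ w) (s : ι) :
    ∑ r, (cscKernel w r s ^ 2 + 2 * |cscKernel w r s * cotKernel w r s|) ≤ 1 / δ ^ 2 := by
  rw [← add_sum_erase _ _ (mem_univ s)]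
  simp only [cscKernel_self, cotKernel_self, mul_zero, abs_zero]
  -- Representatives nearest to zero: separation on the circle forces at least the same separation
  -- of these reals on the line.
  set y : ι → ℝ := fun r => (w r - w s) - round (w r - w s) with hy
  have hyn : ∀ r, |y r| = ‖((w r - w s : ℝ) : UnitAddCircle)‖ := fun r =>
    (UnitAddCircle.norm_eq).symm
  have h := sum_inv_sq_le (univ.erase s) y hδ
    (fun r hr => by rw [hyn]; exact hw r s (ne_of_mem_erase hr))
    (fun r _ t _ hrt => by
      refine (hw r t hrt).trans ?_
      have : ((w r - w t : ℝ) : UnitAddCircle) = ((y r - y t : ℝ) : UnitAddCircle) := by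
        rw [← sub_eq_zero, ← AddCircle.coe_sub, AddCircle.coe_eq_zero_iff]
        refine ⟨round (w r - w s) - round (w t - w s), ?_⟩
        simp only [hy, zsmul_eq_mul, Int.cast_sub]; ring
      rw [this, UnitAddCircle.norm_eq]
      have := round_le (y r - y t) 0
      simpa using this)
  calc _ ≤ ∑ r ∈ univ.erase s, 3 / Real.pi ^ 2 * (1 / y r ^ 2) := by
        simp only [ne_eq, OfNat.ofNat_ne_zero, not_false_eq_true, zero_pow, zero_add]
        refine sum_le_sum fun r hr => ?_
        have := csc_sq_add_le (hδ.trans_le (hw r s (ne_of_mem_erase hr)))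
        rw [← hyn r, sq_abs] at this
        refine this.trans_eq ?_
        rw [div_mul_div_comm, mul_one]
    _ ≤ 3 / Real.pi ^ 2 * (Real.pi ^ 2 / (3 * δ ^ 2)) := by
        rw [← mul_sum]; gcongr
    _ = 1 / δ ^ 2 := by field_simp

/-- The product of two antisymmetric kernels is symmetric, so the arithmetic–geometric mean
inequality on `‖u s‖ ‖u t‖` reduces the form to its row sums. -/
theorem sum_csc_mul_cot_le {ι : Type*} [Fintype ι] (w : ι → ℝ) (u : ι → ℂ) :
    ‖∑ s, ∑ t, ((cscKernel w s t * cotKernel w s t : ℝ) : ℂ) * (u s * conj (u t))‖ ≤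
      ∑ s, ‖u s‖ ^ 2 * ∑ r, |cscKernel w r s * cotKernel w r s| := by
  have hsymm : ∀ s t, |cscKernel w s t * cotKernel w s t| = |cscKernel w t s * cotKernel w t s| :=
    fun s t => by rw [cscKernel_swap w t s, cotKernel_swap w t s, neg_mul_neg]
  calc _ ≤ ∑ s, ∑ t, |cscKernel w s t * cotKernel w s t| * ((‖u s‖ ^ 2 + ‖u t‖ ^ 2) / 2) := by
        refine (norm_sum_le _ _).trans (sum_le_sum fun s _ => (norm_sum_le _ _).trans
          (sum_le_sum fun t _ => ?_))
        rw [norm_mul, norm_mul, Complex.norm_real, Real.norm_eq_abs, RCLike.norm_conj]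
        gcongr
        nlinarith [sq_nonneg (‖u s‖ - ‖u t‖)]
    _ = (∑ s, ∑ t, |cscKernel w s t * cotKernel w s t| * (‖u s‖ ^ 2 / 2)) +
        ∑ s, ∑ t, |cscKernel w s t * cotKernel w s t| * (‖u t‖ ^ 2 / 2) := by
        simp only [← sum_add_distrib]
        refine sum_congr rfl fun s _ => sum_congr rfl fun t _ => by ring
    _ = (∑ s, ∑ t, |cscKernel w t s * cotKernel w t s| * (‖u s‖ ^ 2 / 2)) +
        ∑ s, ∑ t, |cscKernel w t s * cotKernel w t s| * (‖u s‖ ^ 2 / 2) := by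
        congr 1
        · exact sum_congr rfl fun s _ => sum_congr rfl fun t _ => by rw [hsymm]
        · exact sum_comm
    _ = _ := by
        simp only [← sum_add_distrib, mul_sum]
        refine sum_congr rfl fun s _ => sum_congr rfl fun t _ => by ring

/-- Expand `‖A u‖² = μ² ‖u‖²` for the kernel matrix `A` using the product identity. The terms with
sums of cotangents have no useful bound, but they cancel when `u` is an eigenvector; this is why
eigenvectors are treated before general vectors. -/
theorem Separated.eigenvalue_sq_le {ι : Type*} [Fintype ι] [DecidableEq ι] {δ : ℝ} {w : ι → ℝ}
    (hδ : 0 < δ) (hw : Separated δ w) {u : ι → ℂ} (hu : u ≠ 0) {μ : ℝ}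
    (h : ∀ r, ∑ s, (cscKernel w r s : ℂ) * u s = Complex.I * μ * u r) : μ ^ 2 ≤ 1 / δ ^ 2 := by
  have hN : 0 < ∑ r, ‖u r‖ ^ 2 := by
    obtain ⟨r, hr⟩ := Function.ne_iff.1 hu
    have hr' : 0 < ‖u r‖ := norm_pos_iff.2 hr
    exact sum_pos' (fun _ _ => by positivity) ⟨r, mem_univ _, by positivity⟩
  have hc : ∀ r, ∑ t, (cscKernel w r t : ℂ) * conj (u t) = -(Complex.I * μ) * conj (u r) := by
    intro r
    have := congrArg conj (h r)
    simpa [map_sum, mul_comm] using this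
  have hsq : ∀ z : ℂ, z * conj z = ((‖z‖ ^ 2 : ℝ) : ℂ) := fun z => by
    rw [Complex.mul_conj, Complex.normSq_eq_norm_sq]
  have e1 : ∑ r, (∑ s, (cscKernel w r s : ℂ) * u s) * (∑ t, (cscKernel w r t : ℂ) * conj (u t)) =
      ((μ ^ 2 * ∑ r, ‖u r‖ ^ 2 : ℝ) : ℂ) := by
    push_cast
    rw [mul_sum]
    refine sum_congr rfl fun r _ => ?_
    rw [h, hc, ← Complex.ofReal_pow ‖u r‖, ← hsq]
    linear_combination (-(μ:ℂ)^2 * u r * conj (u r)) * Complex.I_sq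
  have e2 : ∑ r, (∑ s, (cscKernel w r s : ℂ) * u s) * (∑ t, (cscKernel w r t : ℂ) * conj (u t)) =
      ∑ s, ∑ t, ((∑ r, cscKernel w r s * cscKernel w r t : ℝ) : ℂ) * (u s * conj (u t)) := by
    simp only [Complex.ofReal_sum, sum_mul]
    rw [sum_comm]
    refine sum_congr rfl fun s _ => ?_
    simp only [mul_sum]
    rw [sum_comm]
    refine sum_congr rfl fun t _ => sum_congr rfl fun r _ => ?_
    push_cast; ring
  set K : ι → ℝ := fun s => ∑ r, cotKernel w r s with hK
  -- In each half one of the two sums is evaluated by the eigenvector equation (directly or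
  -- conjugated), and both halves give the same value.
  have e3 : ∑ s, ∑ t, ((cscKernel w s t * (K s - K t) : ℝ) : ℂ) * (u s * conj (u t)) = 0 := by
    have a1 : ∑ s, ∑ t, (cscKernel w s t : ℂ) * K s * (u s * conj (u t)) =
        ∑ s, -(Complex.I * μ) * (K s * (u s * conj (u s))) := by
      refine sum_congr rfl fun s _ => ?_
      have : ∀ t, (cscKernel w s t : ℂ) * K s * (u s * conj (u t)) =
          K s * u s * ((cscKernel w s t : ℂ) * conj (u t)) := fun t => by ring
      simp only [this]
      rw [← mul_sum, hc]; ring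
    have a2 : ∑ s, ∑ t, (cscKernel w s t : ℂ) * K t * (u s * conj (u t)) =
        ∑ s, -(Complex.I * μ) * (K s * (u s * conj (u s))) := by
      rw [sum_comm]
      refine sum_congr rfl fun t _ => ?_
      have : ∀ s, (cscKernel w s t : ℂ) * K t * (u s * conj (u t)) =
          -(K t * conj (u t)) * ((cscKernel w t s : ℂ) * u s) := fun s => by
        rw [cscKernel_swap w t s]; push_cast; ring
      simp only [this]
      rw [← mul_sum, h]; ring
    rw [← sub_eq_zero.2 (a1.trans a2.symm), ← sum_sub_distrib]
    refine sum_congr rfl fun s _ => ?_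
    rw [← sum_sub_distrib]
    refine sum_congr rfl fun t _ => ?_
    push_cast; ring
  have e4 : ∑ s, ∑ t, ((∑ r, cscKernel w r s * cscKernel w r t : ℝ) : ℂ) * (u s * conj (u t)) =
      2 * (∑ s, ∑ t, ((cscKernel w s t * cotKernel w s t : ℝ) : ℂ) * (u s * conj (u t))) +
      ((∑ s, ‖u s‖ ^ 2 * ∑ r, cscKernel w r s ^ 2 : ℝ) : ℂ) := by
    rw [← zero_add (2 * _), ← e3, mul_sum, ← sum_add_distrib, Complex.ofReal_sum,
      ← sum_add_distrib]
    refine sum_congr rfl fun s _ => ?_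
    have : ((‖u s‖ ^ 2 * ∑ r, cscKernel w r s ^ 2 : ℝ) : ℂ) =
        ∑ t, if s = t then ((∑ r, cscKernel w r s ^ 2 : ℝ) : ℂ) * (u s * conj (u t)) else 0 := by
      rw [sum_ite_eq]; simp only [mem_univ, if_true, hsq]; push_cast; ring
    rw [this, mul_sum, ← sum_add_distrib, ← sum_add_distrib]
    refine sum_congr rfl fun t _ => ?_
    rw [sum_cscKernel_mul_cscKernel hδ hw]
    split_ifs <;> push_cast <;> simp only [hK] <;> push_cast <;> ring
  have key : μ ^ 2 * ∑ r, ‖u r‖ ^ 2 ≤ 1 / δ ^ 2 * ∑ r, ‖u r‖ ^ 2 := by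
    have n1 : ‖((μ ^ 2 * ∑ r, ‖u r‖ ^ 2 : ℝ) : ℂ)‖ = μ ^ 2 * ∑ r, ‖u r‖ ^ 2 := by
      rw [Complex.norm_real, Real.norm_of_nonneg (by positivity)]
    rw [← n1, ← e1, e2, e4]
    refine (norm_add_le _ _).trans ?_
    rw [norm_mul, Complex.norm_real, Real.norm_of_nonneg (by positivity), Complex.norm_two]
    have := sum_csc_mul_cot_le w u
    calc _ ≤ 2 * (∑ s, ‖u s‖ ^ 2 * ∑ r, |cscKernel w r s * cotKernel w r s|) +
          ∑ s, ‖u s‖ ^ 2 * ∑ r, cscKernel w r s ^ 2 := by gcongr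
      _ = ∑ s, ‖u s‖ ^ 2 *
          ∑ r, (cscKernel w r s ^ 2 + 2 * |cscKernel w r s * cotKernel w r s|) := by
          rw [mul_sum, ← sum_add_distrib]
          refine sum_congr rfl fun s _ => ?_
          rw [sum_add_distrib, ← mul_sum]; ring
      _ ≤ ∑ s, ‖u s‖ ^ 2 * (1 / δ ^ 2) := by
          gcongr with s _
          exact hw.sum_csc_sq_add_le hδ s
      _ = _ := by rw [← sum_mul, mul_comm]
  exact le_of_mul_le_mul_right key hN

end Esprit

/-! ### Hilbert's inequality and the two-sided large sieve. -/

namespace Esprit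

open Finset ComplexConjugate
open scoped ComplexOrder

theorem _root_.Matrix.IsHermitian.re_dotProduct_mulVec_le {ι : Type*} [Fintype ι] [DecidableEq ι]
    {A : Matrix ι ι ℂ} (hA : A.IsHermitian) {c : ℝ}
    (h : ∀ (μ : ℝ) (u : ι → ℂ), u ≠ 0 → A.mulVec u = (μ : ℂ) • u → μ ≤ c) (v : ι → ℂ) :
    (star v ⬝ᵥ A.mulVec v).re ≤ c * ∑ i, ‖v i‖ ^ 2 := by
  have hB : ((c : ℂ) • (1 : Matrix ι ι ℂ) - A).IsHermitian := by
    refine Matrix.IsHermitian.sub ?_ hA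
    rw [Matrix.IsHermitian, Matrix.conjTranspose_smul, Matrix.conjTranspose_one]
    simp
  have hpos : ((c : ℂ) • (1 : Matrix ι ι ℂ) - A).PosSemidef := by
    refine hB.posSemidef_iff_eigenvalues_nonneg.2 fun i => ?_
    have he := hB.mulVec_eigenvectorBasis i
    have hne : (hB.eigenvectorBasis i : ι → ℂ) ≠ 0 := fun h0 =>
      hB.eigenvectorBasis.orthonormal.ne_zero i (by ext j; exact congrFun h0 j)
    rw [Matrix.sub_mulVec, Matrix.smul_mulVec, Matrix.one_mulVec] at he
    have := h (c - hB.eigenvalues i) _ hne (by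
      rw [sub_eq_iff_eq_add] at he
      push_cast
      rw [sub_smul, he, Complex.coe_smul (hB.eigenvalues i), add_sub_cancel_left])
    simpa using this
  have h1 := hpos.re_dotProduct_nonneg v
  rw [Matrix.sub_mulVec, Matrix.smul_mulVec, Matrix.one_mulVec, dotProduct_sub,
    dotProduct_smul] at h1
  have h2 : star v ⬝ᵥ v = ((∑ i, ‖v i‖ ^ 2 : ℝ) : ℂ) := by
    rw [dotProduct, Complex.ofReal_sum]
    refine sum_congr rfl fun i _ => ?_
    rw [Pi.star_apply, RCLike.star_def, mul_comm, Complex.mul_conj, Complex.normSq_eq_norm_sq]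
  rw [h2, smul_eq_mul, ← Complex.ofReal_mul, RCLike.re_to_complex, Complex.sub_re,
    Complex.ofReal_re] at h1
  linarith

/-- The generalized Hilbert inequality of Montgomery and Vaughan. -/
theorem Separated.norm_sum_csc_le {ι : Type*} [Fintype ι] [DecidableEq ι] {δ : ℝ} {w : ι → ℝ}
    (hδ : 0 < δ) (hw : Separated δ w) (v : ι → ℂ) :
    ‖∑ r, ∑ s, (cscKernel w r s : ℂ) * (v r * conj (v s))‖ ≤ δ⁻¹ * ∑ r, ‖v r‖ ^ 2 := by
  -- Multiplying by `I` makes the real antisymmetric kernel Hermitian, so the bound on eigenvalues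
  -- bounds the quadratic forms of `A` and `-A`.
  set A : Matrix ι ι ℂ := Matrix.of fun r s => Complex.I * cscKernel w r s with hAdef
  have hA : A.IsHermitian := by
    ext r s
    rw [Matrix.conjTranspose_apply, hAdef, Matrix.of_apply, Matrix.of_apply, cscKernel_swap w r s]
    simp
  have hbd : ∀ (μ : ℝ) (u : ι → ℂ), u ≠ 0 → A.mulVec u = (μ : ℂ) • u → |μ| ≤ δ⁻¹ := by
    intro μ u hu h
    have := hw.eigenvalue_sq_le hδ hu (μ := -μ) fun r => by
      have hr := congrFun h r
      simp only [Matrix.mulVec, dotProduct, hAdef, Matrix.of_apply, Pi.smul_apply,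
        smul_eq_mul, mul_assoc, ← mul_sum] at hr
      push_cast
      linear_combination (-Complex.I) * hr + (∑ s, (cscKernel w r s : ℂ) * u s) * Complex.I_sq
    rw [neg_sq, one_div, ← inv_pow] at this
    exact abs_le_of_sq_le_sq this (by positivity)
  have hform : ∀ u : ι → ℂ, star u ⬝ᵥ A.mulVec u =
      -Complex.I * ∑ r, ∑ s, (cscKernel w r s : ℂ) * (u r * conj (u s)) := by
    intro u
    simp only [Matrix.mulVec, dotProduct, hAdef, Matrix.of_apply, Pi.star_apply, RCLike.star_def,
      mul_sum]
    rw [sum_comm]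
    refine sum_congr rfl fun r _ => sum_congr rfl fun s _ => ?_
    rw [cscKernel_swap w r s]; push_cast; ring
  set Q : ℂ := ∑ r, ∑ s, (cscKernel w r s : ℂ) * (v r * conj (v s)) with hQ
  have him : conj Q = -Q := by
    rw [hQ]
    simp only [map_sum, ← sum_neg_distrib]
    rw [sum_comm]
    refine sum_congr rfl fun r _ => sum_congr rfl fun s _ => ?_
    rw [cscKernel_swap w r s]
    simp only [map_mul, Complex.conj_conj, Complex.conj_ofReal]
    push_cast; ring
  have hre : Q.re = 0 := by
    have := congrArg Complex.re him
    simp at this; linarith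
  have h1 := hA.re_dotProduct_mulVec_le (fun μ u hu h => (le_abs_self μ).trans (hbd μ u hu h)) v
  have h2 := hA.neg.re_dotProduct_mulVec_le (fun μ u hu h => (neg_le_abs (-μ)).trans'
    (by rw [neg_neg]) |>.trans (hbd (-μ) u hu (by
      rw [Matrix.neg_mulVec, neg_eq_iff_eq_neg] at h
      rw [h]; push_cast; rw [neg_smul]))) v
  rw [Matrix.neg_mulVec, dotProduct_neg, Complex.neg_re] at h2
  rw [hform, ← hQ] at h1 h2
  have e : (-Complex.I * Q).re = Q.im := by simp
  rw [e] at h1 h2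
  have hn : ‖Q‖ = |Q.im| := by
    conv_lhs => rw [← Complex.re_add_im Q, hre]
    simp
  rw [hn]
  exact abs_le.2 ⟨by linarith, h1⟩

/-- `e(x) = exp(2πix)`. -/
def cexpTwoPi (x : ℝ) : ℂ := Complex.exp (2 * Real.pi * Complex.I * x)

theorem cexpTwoPi_add (x y : ℝ) : cexpTwoPi (x + y) = cexpTwoPi x * cexpTwoPi y := by
  rw [cexpTwoPi, cexpTwoPi, cexpTwoPi, ← Complex.exp_add]; congr 1; push_cast; ring

theorem norm_cexpTwoPi (x : ℝ) : ‖cexpTwoPi x‖ = 1 := by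
  rw [cexpTwoPi, show 2 * (Real.pi : ℂ) * Complex.I * x = ((2 * Real.pi * x : ℝ) : ℂ) * Complex.I by
    push_cast; ring, Complex.norm_exp_ofReal_mul_I]

theorem conj_cexpTwoPi (x : ℝ) : conj (cexpTwoPi x) = cexpTwoPi (-x) := by
  rw [cexpTwoPi, cexpTwoPi, ← Complex.exp_conj]; congr 1; simp [map_ofNat]

/-- A geometric sum telescopes once multiplied by `e(θ/2) - e(-θ/2)`. The right side splits into two
phases, each of which factors over a difference `θ = w j - w l`. -/
theorem sum_cexpTwoPi_mul_sin (N : ℕ) (θ : ℝ) :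
    (∑ k ∈ range N, cexpTwoPi (-(k * θ))) * (2 * Complex.I * (Real.sin (Real.pi * θ) : ℝ)) =
      cexpTwoPi (θ / 2) - cexpTwoPi (-((N - 1 / 2) * θ)) := by
  have hs : 2 * Complex.I * (Real.sin (Real.pi * θ) : ℝ) =
      cexpTwoPi (θ / 2) - cexpTwoPi (-(θ / 2)) := by
    rw [Complex.ofReal_sin, Complex.sin, cexpTwoPi, cexpTwoPi]
    have h1 : 2 * (Real.pi : ℂ) * Complex.I * ((θ / 2 : ℝ) : ℂ) =
      ((Real.pi * θ : ℝ) : ℂ) * Complex.I := by push_cast; ring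
    have h2 : 2 * (Real.pi : ℂ) * Complex.I * ((-(θ / 2) : ℝ) : ℂ) =
      -((Real.pi * θ : ℝ) : ℂ) * Complex.I := by push_cast; ring
    rw [h1, h2]
    linear_combination (Complex.exp (-((Real.pi * θ : ℝ) : ℂ) * Complex.I) -
      Complex.exp (((Real.pi * θ : ℝ) : ℂ) * Complex.I)) * Complex.I_sq
  rw [hs]
  induction N with
  | zero =>
    rw [sum_range_zero, zero_mul, eq_comm, sub_eq_zero]
    congr 1; push_cast; ring
  | succ n ih =>
    rw [sum_range_succ, add_mul, ih, mul_sub, ← cexpTwoPi_add, ← cexpTwoPi_add]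
    rw [show -(n * θ) + θ / 2 = -((n - 1 / 2) * θ) by ring,
      show -(n * θ) + -(θ / 2) = -(((n + 1 : ℕ) - 1 / 2) * θ) by push_cast; ring]
    ring

/-- The large sieve inequality with its companion lower bound. -/
theorem Separated.abs_sum_norm_sq_sub_le {ι : Type*} [Fintype ι] [DecidableEq ι] {δ : ℝ}
    {w : ι → ℝ} (hδ : 0 < δ) (hw : Separated δ w) (N : ℕ) (v : ι → ℂ) :
    |∑ k ∈ range N, ‖∑ j, cexpTwoPi (-(k * w j)) * v j‖ ^ 2 - N * ∑ j, ‖v j‖ ^ 2| ≤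
      δ⁻¹ * ∑ j, ‖v j‖ ^ 2 := by
  -- The off-diagonal part of the sum of squares is `(2i)⁻¹` times the difference of the Hilbert
  -- forms at these two unimodular twists of `v`. Each form is at most `δ⁻¹ ‖v‖²`, and the factor
  -- `1/2` absorbs the two.
  set p : ι → ℂ := fun j => v j * cexpTwoPi (w j / 2) with hp
  set q : ι → ℂ := fun j => v j * cexpTwoPi (-((N - 1 / 2) * w j)) with hq
  set Q : (ι → ℂ) → ℂ := fun u => ∑ r, ∑ s, (cscKernel w r s : ℂ) * (u r * conj (u s)) with hQ
  have hsq : ∀ z : ℂ, ((‖z‖ ^ 2 : ℝ) : ℂ) = z * conj z := fun z => by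
    rw [Complex.mul_conj, Complex.normSq_eq_norm_sq]
  have hnp : ∑ j, ‖p j‖ ^ 2 = ∑ j, ‖v j‖ ^ 2 := by simp [hp, norm_cexpTwoPi]
  have hnq : ∑ j, ‖q j‖ ^ 2 = ∑ j, ‖v j‖ ^ 2 := by simp [hq, norm_cexpTwoPi]
  have key : ((∑ k ∈ range N, ‖∑ j, cexpTwoPi (-(k * w j)) * v j‖ ^ 2 -
      N * ∑ j, ‖v j‖ ^ 2 : ℝ) : ℂ) = (2 * Complex.I)⁻¹ * (Q p - Q q) := by
    have e1 : ∀ k ∈ range N, ((‖∑ j, cexpTwoPi (-(k * w j)) * v j‖ ^ 2 : ℝ) : ℂ) =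
        ∑ j, ∑ l, v j * conj (v l) * cexpTwoPi (-(k * (w j - w l))) := by
      intro k _
      rw [hsq, map_sum, sum_mul_sum]
      refine sum_congr rfl fun j _ => sum_congr rfl fun l _ => ?_
      rw [map_mul, conj_cexpTwoPi,
        show -(k * (w j - w l)) = -(k * w j) + -(-(k * w l)) by ring, cexpTwoPi_add]
      ring
    have e2 : (N : ℂ) * ((∑ j, ‖v j‖ ^ 2 : ℝ) : ℂ) =
        ∑ j, ∑ l, if j = l then N * (v j * conj (v l)) else 0 := by
      rw [Complex.ofReal_sum, mul_sum]
      refine sum_congr rfl fun j _ => ?_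
      rw [sum_ite_eq, if_pos (mem_univ _), hsq]
    rw [Complex.ofReal_sub, Complex.ofReal_sum, sum_congr rfl e1, Complex.ofReal_mul,
      Complex.ofReal_natCast, e2, sum_comm, hQ, ← sum_sub_distrib, ← sum_sub_distrib, mul_sum]
    refine sum_congr rfl fun j _ => ?_
    rw [sum_comm, ← sum_sub_distrib, ← sum_sub_distrib, mul_sum]
    refine sum_congr rfl fun l _ => ?_
    rw [← mul_sum]
    rcases eq_or_ne j l with rfl | hjl
    · simp [cscKernel_self, cexpTwoPi]; ring
    · have hs := hw.sin_ne_zero hδ hjl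
      have hs' : ((Real.sin (Real.pi * (w j - w l)) : ℝ) : ℂ) ≠ 0 := Complex.ofReal_ne_zero.2 hs
      have h := sum_cexpTwoPi_mul_sin N (w j - w l)
      rw [if_neg hjl, sub_zero]
      simp only [hp, hq, cscKernel, map_mul, conj_cexpTwoPi]
      rw [show (w j - w l) / 2 = w j / 2 + -(w l / 2) by ring,
        show -((N - 1 / 2) * (w j - w l)) = -((N - 1 / 2) * w j) + -(-((N - 1 / 2) * w l)) by ring,
        cexpTwoPi_add, cexpTwoPi_add] at h
      have hI : (2 * Complex.I : ℂ) ≠ 0 := mul_ne_zero two_ne_zero Complex.I_ne_zero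
      rw [Complex.ofReal_inv, ← mul_sub, eq_inv_mul_iff_mul_eq₀ hI, eq_inv_mul_iff_mul_eq₀ hs']
      linear_combination (v j * conj (v l)) * h
  rw [← Real.norm_eq_abs, ← Complex.norm_real, key, norm_mul, norm_inv, norm_mul, Complex.norm_two,
    Complex.norm_I, mul_one]
  have h1 := hw.norm_sum_csc_le hδ p
  have h2 := hw.norm_sum_csc_le hδ q
  rw [hnp] at h1
  rw [hnq] at h2
  have h3 := norm_sub_le (Q p) (Q q)
  linarith

end Esprit

/-! ### Matching the eigenvalues of a perturbed diagonal matrix. -/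

namespace Esprit

open Finset Filter Topology

/-- The Euclidean norm of a complex vector. -/
def l2norm {ι : Type*} [Fintype ι] (v : ι → ℂ) : ℝ := ‖(WithLp.toLp 2 v : EuclideanSpace ℂ ι)‖

theorem l2norm_sq {ι : Type*} [Fintype ι] (v : ι → ℂ) : l2norm v ^ 2 = ∑ i, ‖v i‖ ^ 2 :=
  EuclideanSpace.norm_sq_eq _

theorem l2norm_nonneg {ι : Type*} [Fintype ι] (v : ι → ℂ) : 0 ≤ l2norm v := norm_nonneg _

theorem l2norm_pos {ι : Type*} [Fintype ι] {v : ι → ℂ} (hv : v ≠ 0) : 0 < l2norm v :=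
  norm_pos_iff.2 fun h => hv (by simpa using congrArg WithLp.ofLp h)

theorem l2norm_sub_le {ι : Type*} [Fintype ι] (v w : ι → ℂ) :
    l2norm (v - w) ≤ l2norm v + l2norm w := norm_sub_le _ _

theorem l2norm_sub_le_l2norm_sub {ι : Type*} [Fintype ι] (v w : ι → ℂ) :
    l2norm v - l2norm w ≤ l2norm (v - w) := norm_sub_norm_le _ _

theorem card_filter_eq_of_prod_eq {ι : Type*} [Fintype ι] {a b : ι → ℂ}
    (h : ∏ i, (Polynomial.X - Polynomial.C (a i)) = ∏ i, (Polynomial.X - Polynomial.C (b i)))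
    (p : ℂ → Prop) [DecidablePred p] :
    #{i | p (a i)} = #{i | p (b i)} := by
  have hm : ∀ c : ι → ℂ, (∏ i, (Polynomial.X - Polynomial.C (c i))).roots =
      Multiset.map c univ.val := fun c => by
    rw [← Polynomial.roots_multiset_prod_X_sub_C (Multiset.map c univ.val), Multiset.map_map]; rfl
  have h1 := congrArg Polynomial.roots h
  rw [hm, hm] at h1
  have h2 := congrArg (Multiset.countP p) h1
  rwa [Multiset.countP_map, Multiset.countP_map] at h2

/-- The number of roots of a continuous family of monic polynomials in one of two disjoint closed
sets that contain all the roots is constant. -/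
theorem card_roots_filter_eq {ι X : Type*} [Fintype ι] [TopologicalSpace X] [PreconnectedSpace X]
    [SequentialSpace X] {f : X → Polynomial ℂ} {z : X → ι → ℂ}
    (hz : ∀ t, f t = ∏ i, (Polynomial.X - Polynomial.C (z t i)))
    (hf : ∀ x : ℂ, Continuous fun t => (f t).eval x)
    {K K' : Set ℂ} (hK : IsCompact K) (hK' : IsCompact K') (hd : Disjoint K K')
    (hzK : ∀ t i, z t i ∈ K ∪ K') [DecidablePred (· ∈ K)] (t s : X) :
    #{i | z t i ∈ K} = #{i | z s i ∈ K} := by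
  refine PreconnectedSpace.constant (f := fun t => #{i | z t i ∈ K}) inferInstance
    (continuous_iff_seqContinuous.2 ?_)
  intro u t₀ hu
  -- The listing `z` need not be continuous in the parameter. Compactness gives a convergent
  -- subsequence of listings, whose limit must list the roots of `f t₀`; disjoint closed sets then
  -- make membership eventually constant.
  refine tendsto_of_subseq_tendsto fun ns hns => ?_
  have hc : IsCompact (Set.pi Set.univ fun _ : ι => K ∪ K') :=
    isCompact_univ_pi fun _ => hK.union hK'
  obtain ⟨y, -, φ, hmono, hy⟩ := hc.tendsto_subseq (x := fun n => z (u (ns n)))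
    fun n i _ => hzK _ i
  have hφ : Tendsto (fun n => u (ns (φ n))) atTop (𝓝 t₀) :=
    hu.comp (hns.comp hmono.tendsto_atTop)
  refine ⟨φ, ?_⟩
  have hprod : f t₀ = ∏ i, (Polynomial.X - Polynomial.C (y i)) := by
    refine Polynomial.funext fun x => ?_
    have h1 : Tendsto (fun n => (f (u (ns (φ n)))).eval x) atTop (𝓝 ((f t₀).eval x)) :=
      ((hf x).tendsto t₀).comp hφ
    refine tendsto_nhds_unique h1 ?_
    simp only [hz, Polynomial.eval_prod, Polynomial.eval_sub, Polynomial.eval_X, Polynomial.eval_C]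
    exact tendsto_finsetProd _ fun i _ => tendsto_const_nhds.sub ((tendsto_pi_nhds.1 hy) i)
  have hcard := card_filter_eq_of_prod_eq ((hz t₀).symm.trans hprod) (· ∈ K)
  refine tendsto_const_nhds.congr' ?_
  have hev : ∀ᶠ n in atTop, ∀ i, (y i ∈ K ↔ z (u (ns (φ n))) i ∈ K) := by
    refine eventually_all.2 fun i => ?_
    have hyi := (tendsto_pi_nhds.1 hy) i
    by_cases h : y i ∈ K
    · have hn : y i ∉ K' := fun h' => hd.le_bot ⟨h, h'⟩
      filter_upwards [hyi.eventually (hK'.isClosed.isOpen_compl.mem_nhds hn)] with n hn'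
      exact ⟨fun _ => (hzK _ i).resolve_right hn', fun _ => h⟩
    · filter_upwards [hyi.eventually (hK.isClosed.isOpen_compl.mem_nhds h)] with n hn'
      exact ⟨fun h' => absurd h' h, fun h' => absurd h' hn'⟩
  filter_upwards [hev] with n hn
  rw [hcard, Function.comp_apply]
  simp only [hn]

/-- An eigenvector `v` satisfies `(F v) j = (z - d j) v j`; if `z` were farther than `r` from every
`d j`, then `F` would stretch `v` by more than `r`. -/
theorem exists_dist_le_of_isRoot_charpoly {ι : Type*} [Fintype ι] [DecidableEq ι] {d : ι → ℂ}
    {F : Matrix ι ι ℂ} {r : ℝ} (hF : ∀ v, l2norm (F.mulVec v) ≤ r * l2norm v) {z : ℂ}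
    (hz : (Matrix.diagonal d + F).charpoly.eval z = 0) : ∃ j, ‖z - d j‖ ≤ r := by
  by_contra! hcon
  rw [Matrix.eval_charpoly] at hz
  obtain ⟨v, hv, hzv⟩ := Matrix.exists_mulVec_eq_zero_iff.2 hz
  have hFv : ∀ j, (F.mulVec v) j = (z - d j) * v j := fun j => by
    have := congrFun hzv j
    rw [Matrix.sub_mulVec, Matrix.add_mulVec, Pi.sub_apply, Pi.add_apply, Matrix.mulVec_diagonal,
      Matrix.scalar_apply, Matrix.mulVec_diagonal, Pi.zero_apply] at this
    linear_combination -this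
  have hr : 0 ≤ r := nonneg_of_mul_nonneg_left ((l2norm_nonneg _).trans (hF v)) (l2norm_pos hv)
  have h1 := pow_le_pow_left₀ (l2norm_nonneg _) (hF v) 2
  rw [mul_pow, l2norm_sq, l2norm_sq, mul_sum] at h1
  obtain ⟨j, hj⟩ := Function.ne_iff.1 hv
  refine absurd h1 (not_le.2 (sum_lt_sum (fun i _ => ?_) ⟨j, mem_univ _, ?_⟩))
  · rw [hFv, norm_mul, mul_pow]
    gcongr
    exact (hcon i).le
  · rw [hFv, norm_mul, mul_pow]
    have : 0 < ‖v j‖ := norm_pos_iff.2 hj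
    gcongr
    exact hcon j

theorem exists_charpoly_eq_prod {S : ℕ} (A : Matrix (Fin S) (Fin S) ℂ) :
    ∃ lam : Fin S → ℂ, A.charpoly = ∏ j, (Polynomial.X - Polynomial.C (lam j)) := by
  have hs := IsAlgClosed.splits A.charpoly
  have hcard : A.charpoly.roots.card = S := by
    rw [← hs.natDegree_eq_card_roots, Matrix.charpoly_natDegree_eq_dim, Fintype.card_fin]
  have hprod := hs.eq_prod_roots_of_monic (Matrix.charpoly_monic A)
  have hlen : A.charpoly.roots.toList.length = S := by rw [Multiset.length_toList, hcard]
  refine ⟨fun j => A.charpoly.roots.toList.get (j.cast hlen.symm), ?_⟩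
  conv_lhs => rw [hprod, ← Multiset.coe_toList A.charpoly.roots, Multiset.map_coe,
    Multiset.prod_coe]
  rw [← List.prod_ofFn]
  congr 1
  apply List.ext_get
  · simp [hcard]
  · intro n h1 h2
    simp

/-- Eigenvalues of perturbations of a diagonal matrix: the matching distance is at most
`(2S - 1) ‖F‖`. -/
theorem exists_perm_norm_sub_le {S : ℕ} {d mu : Fin S → ℂ} {F : Matrix (Fin S) (Fin S) ℂ} {r : ℝ}
    (hr : 0 ≤ r) (hF : ∀ v, l2norm (F.mulVec v) ≤ r * l2norm v)
    (hmu : (Matrix.diagonal d + F).charpoly = ∏ j, (Polynomial.X - Polynomial.C (mu j))) :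
    ∃ ψ : Equiv.Perm (Fin S), ∀ j, ‖mu (ψ j) - d j‖ ≤ (2 * S - 1) * r := by
  classical
  -- Indices are joined when their disks of radius `r` can meet, so disks from different components
  -- are disjoint.
  set G : SimpleGraph (Fin S) := SimpleGraph.fromRel fun j k => ‖d j - d k‖ ≤ 2 * r with hG
  have hstep : ∀ {j k}, G.Adj j k → ‖d j - d k‖ ≤ 2 * r := fun h => by
    rcases ((SimpleGraph.fromRel_adj _ _ _).1 h).2 with h | h
    · exact h
    · rwa [norm_sub_rev]
  have hwalk : ∀ {j k} (p : G.Walk j k), ‖d j - d k‖ ≤ p.length * (2 * r) := by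
    intro j k p
    induction p with
    | nil => simp
    | cons h p ih =>
      rw [SimpleGraph.Walk.length_cons, Nat.cast_succ, add_mul, one_mul, add_comm]
      refine (norm_sub_le_norm_sub_add_norm_sub _ _ _).trans (add_le_add (hstep h) ih)
  set comp : Fin S → G.ConnectedComponent := G.connectedComponentMk with hcomp
  have hnear : ∀ z j k, ‖z - d j‖ ≤ r → ‖z - d k‖ ≤ r → comp j = comp k := by
    intro z j k hj hk
    rcases eq_or_ne j k with rfl | hne
    · rfl
    · refine SimpleGraph.ConnectedComponent.sound (SimpleGraph.Adj.reachable ?_)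
      refine (SimpleGraph.fromRel_adj _ _ _).2 ⟨hne, Or.inl ?_⟩
      have := norm_sub_le_norm_sub_add_norm_sub (d j) z (d k)
      rw [norm_sub_rev (d j) z] at this
      linarith
  have hscale : ∀ t : unitInterval, ∀ v,
      l2norm (((t : ℝ) : ℂ) • F |>.mulVec v) ≤ r * l2norm v := by
    intro t v
    have : l2norm (((t : ℝ) : ℂ) • F |>.mulVec v) = t * l2norm (F.mulVec v) := by
      rw [Matrix.smul_mulVec, l2norm, WithLp.toLp_smul, norm_smul, Complex.norm_real,
        Real.norm_of_nonneg t.2.1]; rfl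
    rw [this]
    exact (mul_le_of_le_one_left (l2norm_nonneg _) t.2.2).trans (hF v)
  -- Homotopy from `diag(d)` to `diag(d) + F`: no eigenvalue leaves the disks, so each component
  -- keeps its number of eigenvalues.
  set f : unitInterval → Polynomial ℂ := fun t =>
    (Matrix.diagonal d + ((t : ℝ) : ℂ) • F).charpoly with hf
  choose z hz using fun t : unitInterval =>
    exists_charpoly_eq_prod (Matrix.diagonal d + ((t : ℝ) : ℂ) • F)
  have hroot : ∀ t i, ∃ j, ‖z t i - d j‖ ≤ r := fun t i => by
    refine exists_dist_le_of_isRoot_charpoly (hscale t) ?_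
    rw [hz, Polynomial.eval_prod]
    exact prod_eq_zero (mem_univ i) (by simp)
  have hcont : ∀ x : ℂ, Continuous fun t => (f t).eval x := by
    intro x
    simp only [hf, Matrix.eval_charpoly]
    fun_prop
  have hmem : ∀ i, ∃ j, ‖mu i - d j‖ ≤ r := fun i => by
    refine exists_dist_le_of_isRoot_charpoly hF ?_
    rw [hmu, Polynomial.eval_prod]
    exact prod_eq_zero (mem_univ i) (by simp)
  choose g hg using hmem
  have hfib : ∀ c, #{j | comp j = c} = #{i | comp (g i) = c} := by
    intro c
    set K : Set ℂ := ⋃ j ∈ {j | comp j = c}, Metric.closedBall (d j) r with hK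
    set K' : Set ℂ := ⋃ j ∈ {j | comp j ≠ c}, Metric.closedBall (d j) r with hK'
    have hmemK : ∀ w, w ∈ K ↔ ∃ j, comp j = c ∧ ‖w - d j‖ ≤ r := fun w => by
      simp [hK, dist_eq_norm]
    have hmemK' : ∀ w, w ∈ K' ↔ ∃ j, comp j ≠ c ∧ ‖w - d j‖ ≤ r := fun w => by
      simp [hK', dist_eq_norm]
    have hdisj : Disjoint K K' := by
      rw [Set.disjoint_left]
      intro w hw hw'
      obtain ⟨j, hj, hjw⟩ := (hmemK w).1 hw
      obtain ⟨k, hk, hkw⟩ := (hmemK' w).1 hw'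
      exact hk ((hnear w k j hkw hjw).trans hj)
    have hcard := card_roots_filter_eq (f := f) hz hcont
      ((Set.toFinite {j | comp j = c}).isCompact_biUnion fun j _ => isCompact_closedBall (d j) r)
      ((Set.toFinite {j | comp j ≠ c}).isCompact_biUnion fun j _ => isCompact_closedBall (d j) r)
      hdisj (fun t i => by
        obtain ⟨j, hj⟩ := hroot t i
        by_cases h : comp j = c
        · exact Or.inl ((hmemK _).2 ⟨j, h, hj⟩)
        · exact Or.inr ((hmemK' _).2 ⟨j, h, hj⟩)) 0 1
    have h0 := card_filter_eq_of_prod_eq (a := z 0) (b := d) (by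
      rw [← hz]; simp [Matrix.charpoly_diagonal]) (· ∈ K)
    have h1 := card_filter_eq_of_prod_eq (a := z 1) (b := mu) (by
      rw [← hz, ← hmu]; simp) (· ∈ K)
    rw [h0, h1] at hcard
    have e0 : ∀ j, d j ∈ K ↔ comp j = c := fun j => by
      rw [hmemK]
      refine ⟨fun ⟨k, hk, hjk⟩ => ?_, fun h => ⟨j, h, by simpa using hr⟩⟩
      rw [← hk]; exact hnear (d j) j k (by simpa using hr) hjk
    have e1 : ∀ i, mu i ∈ K ↔ comp (g i) = c := fun i => by
      rw [hmemK]
      refine ⟨fun ⟨k, hk, hik⟩ => ?_, fun h => ⟨g i, h, hg i⟩⟩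
      rw [← hk]; exact hnear (mu i) (g i) k (hg i) hik
    simpa only [e0, e1] using hcard
  have hequiv : ∀ c, Nonempty ({j // comp j = c} ≃ {i // comp (g i) = c}) := fun c => by
    refine Fintype.card_eq.1 ?_
    rw [Fintype.card_subtype, Fintype.card_subtype, hfib]
  have e := fun c => (hequiv c).some
  refine ⟨Equiv.ofFiberEquiv e, fun j => ?_⟩
  have hj : comp (g (Equiv.ofFiberEquiv e j)) = comp j :=
    Equiv.ofFiberEquiv_map (g := fun i => comp (g i)) e j
  -- A path in the component has at most `S - 1` edges of length at most `2r`; with the final radius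
  -- `r` this totals `(2S - 1) r`.
  obtain ⟨p, hp⟩ := (SimpleGraph.ConnectedComponent.exact hj).exists_isPath
  have hlen : (p.length : ℝ) + 1 ≤ S := by
    have := hp.length_lt
    rw [Fintype.card_fin] at this
    exact_mod_cast this
  have h1 := hwalk p
  have h2 := hg (Equiv.ofFiberEquiv e j)
  refine (norm_sub_le_norm_sub_add_norm_sub _ (d (g (Equiv.ofFiberEquiv e j))) _).trans ?_
  nlinarith

end Esprit

/-! ### Singular value decompositions, projections and pseudoinverses. -/

namespace Esprit

open Finset
open scoped ComplexOrder Matrix Matrix.Norms.L2Operator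

theorem l2norm_mulVec_le {m n : Type*} [Fintype m] [Fintype n] [DecidableEq n] (A : Matrix m n ℂ)
    (v : n → ℂ) : l2norm (A *ᵥ v) ≤ ‖A‖ * l2norm v :=
  A.l2_opNorm_mulVec (WithLp.toLp 2 v)

theorem norm_le_of_l2norm_mulVec_le {m n : Type*} [Fintype m] [Fintype n] [DecidableEq n]
    {A : Matrix m n ℂ} {c : ℝ} (hc : 0 ≤ c) (h : ∀ v, l2norm (A *ᵥ v) ≤ c * l2norm v) :
    ‖A‖ ≤ c := by
  rw [Matrix.l2_opNorm_def]
  exact ContinuousLinearMap.opNorm_le_bound _ hc fun v => h v.ofLp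

theorem l2norm_conjTranspose_mulVec_le {m n : Type*} [Fintype m] [Fintype n] [DecidableEq m]
    [DecidableEq n] {A : Matrix m n ℂ} {c : ℝ} (hc : 0 ≤ c)
    (h : ∀ v, l2norm (A *ᵥ v) ≤ c * l2norm v) (x : m → ℂ) :
    l2norm (Aᴴ *ᵥ x) ≤ c * l2norm x := by
  refine (l2norm_mulVec_le _ _).trans (mul_le_mul_of_nonneg_right ?_ (l2norm_nonneg _))
  rw [Matrix.l2_opNorm_conjTranspose]
  exact norm_le_of_l2norm_mulVec_le hc h

theorem star_dotProduct_self {n : Type*} [Fintype n] (v : n → ℂ) :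
    star v ⬝ᵥ v = ((l2norm v ^ 2 : ℝ) : ℂ) := by
  rw [l2norm_sq, dotProduct, Complex.ofReal_sum]
  refine sum_congr rfl fun i _ => ?_
  rw [Pi.star_apply, RCLike.star_def, mul_comm, Complex.mul_conj, Complex.normSq_eq_norm_sq]

theorem l2norm_mulVec_eq {m n : Type*} [Fintype m] [Fintype n] [DecidableEq n]
    {A : Matrix m n ℂ} (hA : Aᴴ * A = 1) (v : n → ℂ) : l2norm (A *ᵥ v) = l2norm v := by
  have h : ((l2norm (A *ᵥ v) ^ 2 : ℝ) : ℂ) = ((l2norm v ^ 2 : ℝ) : ℂ) := by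
    rw [← star_dotProduct_self, ← star_dotProduct_self, Matrix.star_mulVec,
      ← Matrix.dotProduct_mulVec, Matrix.mulVec_mulVec, hA, Matrix.one_mulVec]
  exact (pow_left_inj₀ (l2norm_nonneg _) (l2norm_nonneg _) two_ne_zero).1 (Complex.ofReal_injective h)

theorem l2norm_mulVec_le_of_projection {n : Type*} [Fintype n] [DecidableEq n]
    {P : Matrix n n ℂ} (hP : P.IsHermitian) (hP2 : P * P = P) (v : n → ℂ) :
    l2norm (P *ᵥ v) ≤ l2norm v := by
  have h := P.l2_opNorm_conjTranspose_mul_self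
  rw [hP.eq, hP2] at h
  have h1 : ‖P‖ ≤ 1 := by
    by_contra hlt
    rw [not_le] at hlt
    nlinarith
  exact (l2norm_mulVec_le P v).trans (mul_le_of_le_one_left (l2norm_nonneg _) h1)

theorem l2norm_le_of_norm_le {n : Type*} [Fintype n] {c : ℝ} (hc : 0 ≤ c) {v w : n → ℂ}
    (h : ∀ i, ‖v i‖ ≤ c * ‖w i‖) : l2norm v ≤ c * l2norm w := by
  refine le_of_sq_le_sq ?_ (mul_nonneg hc (l2norm_nonneg _))
  rw [mul_pow, l2norm_sq, l2norm_sq, mul_sum]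
  exact sum_le_sum fun i _ => by
    rw [← mul_pow]; exact pow_le_pow_left₀ (norm_nonneg _) (h i) 2

theorem rectDiagonal_self (n : ℕ) (σ : ℕ → ℝ) :
    rectDiagonal n n σ = Matrix.diagonal fun i : Fin n => ((σ i : ℝ) : ℂ) := by
  ext i j
  simp [rectDiagonal, Matrix.diagonal_apply, Fin.ext_iff]

theorem firstCols_eq_mul {m n S : ℕ} (h : S ≤ n) (W : Matrix (Fin m) (Fin n) ℂ) :
    firstCols h W = W * firstCols h (1 : Matrix (Fin n) (Fin n) ℂ) := by
  ext i j
  simp only [firstCols, Matrix.mul_apply, Matrix.submatrix_apply, id, Matrix.one_apply]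
  simp

theorem firstCols_one_mul_conjTranspose {n S : ℕ} (h : S ≤ n) :
    firstCols h (1 : Matrix (Fin n) (Fin n) ℂ) * (firstCols h (1 : Matrix (Fin n) (Fin n) ℂ))ᴴ =
      Matrix.diagonal fun i : Fin n => if (i : ℕ) < S then 1 else 0 := by
  ext i k
  simp only [firstCols, Matrix.mul_apply, Matrix.conjTranspose_apply, Matrix.submatrix_apply, id,
    Matrix.one_apply, Matrix.diagonal_apply]
  by_cases hi : (i : ℕ) < S
  · rw [sum_eq_single (⟨i, hi⟩ : Fin S)]
    · have : Fin.castLE h ⟨i, hi⟩ = i := rfl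
      simp only [this, if_true, hi, one_mul]
      rcases eq_or_ne i k with rfl | hik
      · simp
      · simp [hik, hik.symm]
    · intro b _ hb
      rw [if_neg (fun h' : i = Fin.castLE h b => hb (Fin.ext (congrArg Fin.val h').symm)), zero_mul]
    · simp
  · rw [sum_eq_zero]
    · simp [hi]
    · intro b _
      rw [if_neg (fun h' => hi (by rw [h']; exact b.2)), zero_mul]

theorem conjTranspose_firstCols_mul {n S : ℕ} (h : S ≤ n) {W : Matrix (Fin n) (Fin n) ℂ}
    (hW : W ∈ Matrix.unitaryGroup (Fin n) ℂ) : (firstCols h W)ᴴ * firstCols h W = 1 := by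
  have h1 : Wᴴ * W = 1 := Matrix.mem_unitaryGroup_iff'.1 hW
  have h2 : (firstCols h W)ᴴ * firstCols h W = (Wᴴ * W).submatrix (Fin.castLE h) (Fin.castLE h) :=
    rfl
  rw [h2, h1]
  exact Matrix.submatrix_one _ (Fin.castLE_injective h)

/-- The orthogonal projection onto the complement of the leading columns of a unitary matrix. -/
theorem l2norm_sub_firstCols_mulVec {n S : ℕ} (h : S ≤ n) {W : Matrix (Fin n) (Fin n) ℂ}
    (hW : W ∈ Matrix.unitaryGroup (Fin n) ℂ) (z : Fin n → ℂ) :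
    l2norm (W *ᵥ z - firstCols h W *ᵥ ((firstCols h W)ᴴ *ᵥ (W *ᵥ z))) =
      l2norm fun i : Fin n => if (i : ℕ) < S then 0 else z i := by
  have h1 : Wᴴ * W = 1 := Matrix.mem_unitaryGroup_iff'.1 hW
  rw [← l2norm_mulVec_eq h1 fun i : Fin n => if (i : ℕ) < S then 0 else z i]
  congr 1
  have : (fun i : Fin n => if (i : ℕ) < S then 0 else z i) =
      z - Matrix.diagonal (fun i : Fin n => if (i : ℕ) < S then (1 : ℂ) else 0) *ᵥ z := by
    ext i
    rw [Pi.sub_apply, Matrix.mulVec_diagonal]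
    split_ifs <;> simp
  rw [this, Matrix.mulVec_sub, ← firstCols_one_mul_conjTranspose h, firstCols_eq_mul h W,
    Matrix.conjTranspose_mul]
  simp only [Matrix.mulVec_mulVec, Matrix.mul_assoc]
  rw [h1, Matrix.mul_one]

theorem l2norm_sub_firstCols_mulVec_le {n S : ℕ} (h : S ≤ n) {W : Matrix (Fin n) (Fin n) ℂ}
    (hW : W ∈ Matrix.unitaryGroup (Fin n) ℂ) (x : Fin n → ℂ) :
    l2norm (x - firstCols h W *ᵥ ((firstCols h W)ᴴ *ᵥ x)) ≤ l2norm x := by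
  have h1 : Wᴴ * W = 1 := Matrix.mem_unitaryGroup_iff'.1 hW
  have h2 : W * Wᴴ = 1 := Matrix.mem_unitaryGroup_iff.1 hW
  have hx : x = W *ᵥ (Wᴴ *ᵥ x) := by rw [Matrix.mulVec_mulVec, h2, Matrix.one_mulVec]
  have h3 := l2norm_sub_firstCols_mulVec h hW (Wᴴ *ᵥ x)
  rw [← hx] at h3
  rw [h3]
  have h4 : l2norm (Wᴴ *ᵥ x) = l2norm x :=
    l2norm_mulVec_eq (by rw [Matrix.conjTranspose_conjTranspose, h2]) x
  rw [← h4, ← one_mul (l2norm (Wᴴ *ᵥ x))]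
  refine l2norm_le_of_norm_le zero_le_one fun i => ?_
  split_ifs <;> simp

/-- Weyl's argument: the first `S + 1` right singular vectors span a space that meets the kernel of
`Q`. On such a vector `H - P * Q` acts as `H`, which stretches it by at least `σ S`, the `(S +
1)`-st singular value since indices start at zero. -/
theorem IsSVD.singularValue_le {m n S : ℕ} (hmn : m = n) (hS : S < m)
    {H : Matrix (Fin m) (Fin n) ℂ} {W : Matrix (Fin m) (Fin m) ℂ} {σ : ℕ → ℝ}
    {V : Matrix (Fin n) (Fin n) ℂ} (h : IsSVD H W σ V) {P : Matrix (Fin m) (Fin S) ℂ}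
    {Q : Matrix (Fin S) (Fin n) ℂ} {ε : ℝ}
    (hN : ∀ v, l2norm ((H - P * Q) *ᵥ v) ≤ ε * l2norm v) : σ S ≤ ε := by
  subst hmn
  have hV : Vᴴ * V = 1 := Matrix.mem_unitaryGroup_iff'.1 h.right_unitary
  have hW : Wᴴ * W = 1 := Matrix.mem_unitaryGroup_iff'.1 h.left_unitary
  set J : Matrix (Fin m) (Fin (S + 1)) ℂ := firstCols hS 1 with hJ
  have hJJ : Jᴴ * J = 1 := conjTranspose_firstCols_mul hS (one_mem _)
  have hker := LinearMap.ker_ne_bot_of_finrank_lt (f := (Q * (V * J)).mulVecLin) (by simp)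
  obtain ⟨c, hc, hc0⟩ := (Submodule.ne_bot_iff _).1 hker
  rw [LinearMap.mem_ker, Matrix.mulVecLin_apply, ← Matrix.mulVec_mulVec] at hc
  have hv : l2norm ((V * J) *ᵥ c) = l2norm c := l2norm_mulVec_eq (by
    rw [Matrix.conjTranspose_mul, Matrix.mul_assoc, ← Matrix.mul_assoc Vᴴ, hV, Matrix.one_mul,
      hJJ]) c
  have h1 := hN ((V * J) *ᵥ c)
  rw [Matrix.sub_mulVec, ← Matrix.mulVec_mulVec _ P Q, hc, Matrix.mulVec_zero, sub_zero, hv,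
    h.eq_mul, rectDiagonal_self, Matrix.mulVec_mulVec, Matrix.mul_assoc, ← Matrix.mul_assoc Vᴴ, hV,
    Matrix.one_mul, Matrix.mul_assoc, ← Matrix.mulVec_mulVec, l2norm_mulVec_eq hW,
    ← Matrix.mulVec_mulVec] at h1
  have h2 : σ S * l2norm c ≤ l2norm (Matrix.diagonal (fun i : Fin m => ((σ i : ℝ) : ℂ)) *ᵥ
      (J *ᵥ c)) := by
    rw [← l2norm_mulVec_eq hJJ c]
    refine le_of_sq_le_sq ?_ (l2norm_nonneg _)
    rw [mul_pow, l2norm_sq, l2norm_sq, mul_sum]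
    refine sum_le_sum fun i _ => ?_
    rw [Matrix.mulVec_diagonal, norm_mul, Complex.norm_real, Real.norm_of_nonneg (h.nonneg _),
      mul_pow]
    by_cases hi : (i : ℕ) ≤ S
    · have := h.antitone hi
      have := h.nonneg S
      gcongr
    · have : (J *ᵥ c) i = 0 := by
        rw [Matrix.mulVec, dotProduct]
        refine sum_eq_zero fun j _ => ?_
        rw [hJ, firstCols, Matrix.submatrix_apply, Matrix.one_apply, if_neg, zero_mul]
        intro h'
        have : (i : ℕ) = j := congrArg Fin.val h'
        omega
      simp [this]
  exact le_of_mul_le_mul_right (h2.trans h1) (l2norm_pos hc0)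

/-- The leading left singular vectors of a perturbation of a matrix of rank at most `S` almost span
its range. -/
theorem IsSVD.l2norm_sub_firstCols_mulVec_le {m n S : ℕ} (hmn : m = n) (hS : S < m)
    {H : Matrix (Fin m) (Fin n) ℂ} {W : Matrix (Fin m) (Fin m) ℂ} {σ : ℕ → ℝ}
    {V : Matrix (Fin n) (Fin n) ℂ} (h : IsSVD H W σ V) {P : Matrix (Fin m) (Fin S) ℂ}
    {Q : Matrix (Fin S) (Fin n) ℂ} {ε : ℝ}
    (hN : ∀ v, l2norm ((H - P * Q) *ᵥ v) ≤ ε * l2norm v) (v : Fin n → ℂ) :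
    l2norm ((P * Q) *ᵥ v - firstCols hS.le W *ᵥ ((firstCols hS.le W)ᴴ *ᵥ ((P * Q) *ᵥ v))) ≤
      2 * ε * l2norm v := by
  have hσ := h.singularValue_le hmn hS hN
  subst hmn
  have hV : V * Vᴴ = 1 := Matrix.mem_unitaryGroup_iff.1 h.right_unitary
  -- The projection off the leading columns leaves at most `σ S ≤ ε` of `H` and at most `ε` of the
  -- error, whence `2 * ε`.
  have e1 : (P * Q) *ᵥ v = H *ᵥ v - (H - P * Q) *ᵥ v := by
    rw [Matrix.sub_mulVec, sub_sub_cancel]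
  have e2 : l2norm (H *ᵥ v - firstCols hS.le W *ᵥ ((firstCols hS.le W)ᴴ *ᵥ (H *ᵥ v))) ≤
      ε * l2norm v := by
    rw [h.eq_mul, ← Matrix.mulVec_mulVec, ← Matrix.mulVec_mulVec,
      l2norm_sub_firstCols_mulVec hS.le h.left_unitary, rectDiagonal_self]
    have h4 : l2norm (Vᴴ *ᵥ v) = l2norm v :=
      l2norm_mulVec_eq (by rw [Matrix.conjTranspose_conjTranspose, hV]) v
    rw [← h4]
    have h0 := h.nonneg S
    refine l2norm_le_of_norm_le (h0.trans hσ) fun i => ?_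
    split_ifs with hi
    · rw [norm_zero]; exact mul_nonneg (h0.trans hσ) (norm_nonneg _)
    · rw [Matrix.mulVec_diagonal, norm_mul, Complex.norm_real, Real.norm_of_nonneg (h.nonneg _)]
      gcongr
      exact (h.antitone (not_lt.1 hi)).trans hσ
  have e3 := (Esprit.l2norm_sub_firstCols_mulVec_le hS.le h.left_unitary
    ((H - P * Q) *ᵥ v)).trans (hN v)
  have e4 := (l2norm_sub_le _ _).trans (add_le_add e2 e3)
  rw [e1, Matrix.mulVec_sub, Matrix.mulVec_sub, sub_sub_sub_comm]
  linarith

theorem exists_isPinv {m n : ℕ} {A : Matrix (Fin m) (Fin n) ℂ}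
    (hA : ∀ v, A *ᵥ v = 0 → v = 0) : ∃ B, IsPinv A B := by
  have hdet : IsUnit (Aᴴ * A).det := by
    rw [isUnit_iff_ne_zero, Ne, ← Matrix.exists_mulVec_eq_zero_iff]
    rintro ⟨v, hv, h⟩
    exact hv (hA v ((Matrix.conjTranspose_mul_self_mulVec_eq_zero A v).1 h))
  have hB : (Aᴴ * A)⁻¹ * Aᴴ * A = 1 := by
    rw [Matrix.mul_assoc, Matrix.nonsing_inv_mul _ hdet]
  refine ⟨(Aᴴ * A)⁻¹ * Aᴴ, ?_, ?_, ?_, ?_⟩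
  · rw [Matrix.mul_assoc, hB, Matrix.mul_one]
  · rw [hB, Matrix.one_mul]
  · rw [← Matrix.mul_assoc]
    exact Matrix.isHermitian_mul_mul_conjTranspose _ (Matrix.isHermitian_conjTranspose_mul_self A).inv
  · rw [hB]; exact Matrix.isHermitian_one

/-- Right singular vectors are eigenvectors of `Aᴴ * A`; their normalized images, where nonzero, are
orthonormal and extend to a basis of left singular vectors. This is needed for the existence of an
output. -/
theorem exists_isSVD_of_eq {m n : ℕ} (hmn : m = n) (A : Matrix (Fin m) (Fin n) ℂ) :
    ∃ W σ V, IsSVD A W σ V := by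
  subst hmn
  have hB : (Aᴴ * A).IsHermitian := Matrix.isHermitian_conjTranspose_mul_self A
  have hcard : m = Fintype.card (Fin m) := (Fintype.card_fin m).symm
  -- `eigenvalues₀` is sorted but the eigenvector basis follows the indexing of `eigenvalues`; `e`
  -- translates between them.
  set e : Fin m ≃ Fin m := (finCongr hcard).trans (Fintype.equivOfCardEq (Fintype.card_fin _))
  set b : OrthonormalBasis (Fin m) ℂ (EuclideanSpace ℂ (Fin m)) :=
    hB.eigenvectorBasis.reindex e.symm with hb
  set μ : Fin m → ℝ := fun i => hB.eigenvalues₀ (i.cast hcard) with hμ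
  have hμe : ∀ i, μ i = hB.eigenvalues (e i) := fun i => by
    simp [hμ, Matrix.IsHermitian.eigenvalues, e]
  have hμanti : Antitone μ := fun i j hij => hB.eigenvalues₀_antitone hij
  have hμ0 : ∀ i, 0 ≤ μ i := fun i => by
    rw [hμe]; exact Matrix.eigenvalues_conjTranspose_mul_self_nonneg A _
  have heig : ∀ i, (Aᴴ * A) *ᵥ (b i).ofLp = (μ i : ℂ) • (b i).ofLp := fun i => by
    rw [hμe, Complex.coe_smul, hb, OrthonormalBasis.reindex_apply, Equiv.symm_symm]
    exact hB.mulVec_eigenvectorBasis (e i)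
  set u : Fin m → EuclideanSpace ℂ (Fin m) := fun i => WithLp.toLp 2 (A *ᵥ (b i).ofLp) with hu
  have hinner : ∀ i j, inner ℂ (u i) (u j) = if i = j then (μ j : ℂ) else 0 := fun i j => by
    have h1 : inner ℂ (u i) (u j) = (μ j : ℂ) * inner ℂ (b i) (b j) := by
      rw [EuclideanSpace.inner_eq_star_dotProduct, EuclideanSpace.inner_eq_star_dotProduct,
        dotProduct_comm, dotProduct_comm (b j).ofLp]
      simp only [hu]
      rw [Matrix.star_mulVec, ← Matrix.dotProduct_mulVec, Matrix.mulVec_mulVec, heig,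
        dotProduct_smul, smul_eq_mul]
    rw [h1, orthonormal_iff_ite.1 b.orthonormal]
    split_ifs <;> simp
  set s : Set (Fin m) := {i | μ i ≠ 0} with hs
  set w : Fin m → EuclideanSpace ℂ (Fin m) := fun i => ((√(μ i))⁻¹ : ℂ) • u i with hw
  have hworth : Orthonormal ℂ (s.domRestrict w) := by
    rw [orthonormal_iff_ite]
    rintro ⟨i, hi⟩ ⟨j, hj⟩
    have hj' : 0 < √(μ j) := Real.sqrt_pos.2 (lt_of_le_of_ne (hμ0 j) (Ne.symm hj))
    have : inner ℂ (w i) (w j) = if i = j then 1 else 0 := by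
      rw [hw, inner_smul_left, inner_smul_right, hinner]
      rcases eq_or_ne i j with rfl | hij
      · simp only [if_true, map_inv₀, Complex.conj_ofReal]
        rw [← Complex.ofReal_inv, ← Complex.ofReal_mul, ← Complex.ofReal_mul, Complex.ofReal_eq_one]
        field_simp
        rw [Real.sq_sqrt (hμ0 i)]
      · simp [hij]
    simpa [Set.domRestrict, Subtype.ext_iff] using this
  obtain ⟨wb, hwb⟩ := hworth.exists_orthonormalBasis_extension_of_card_eq (by simp)
  have hAw : ∀ j, A *ᵥ (b j).ofLp = ((√(μ j) : ℝ) : ℂ) • (wb j).ofLp := fun j => by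
    by_cases hj : μ j = 0
    · have h0 : u j = 0 := by
        rw [← inner_self_eq_zero (𝕜 := ℂ), hinner]; simp [hj]
      have h1 : A *ᵥ (b j).ofLp = 0 := congrArg WithLp.ofLp h0
      rw [h1, hj]; simp
    · have hj' : 0 < √(μ j) := Real.sqrt_pos.2 (lt_of_le_of_ne (hμ0 j) (Ne.symm hj))
      have hj'' : ((√(μ j) : ℝ) : ℂ) ≠ 0 := Complex.ofReal_ne_zero.2 hj'.ne'
      rw [hwb j hj, hw, WithLp.ofLp_smul, smul_smul, mul_inv_cancel₀ hj'', one_smul]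
  have hunit : ∀ c : OrthonormalBasis (Fin m) ℂ (EuclideanSpace ℂ (Fin m)),
      (Matrix.of fun i j => (c j).ofLp i) ∈ Matrix.unitaryGroup (Fin m) ℂ := fun c => by
    rw [Matrix.mem_unitaryGroup_iff']
    ext i j
    have := orthonormal_iff_ite.1 c.orthonormal i j
    rw [EuclideanSpace.inner_eq_star_dotProduct, dotProduct_comm] at this
    rw [Matrix.one_apply, ← this]
    rfl
  refine ⟨Matrix.of fun i j => (wb j).ofLp i, fun k => if h : k < m then √(μ ⟨k, h⟩) else 0,
    Matrix.of fun i j => (b j).ofLp i, hunit wb, hunit b, ?_, ?_, ?_⟩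
  · intro k l hkl
    dsimp only
    split_ifs with h1 h2 h2
    · exact Real.sqrt_le_sqrt (hμanti hkl)
    · omega
    · exact Real.sqrt_nonneg _
    · exact le_rfl
  · intro k
    split_ifs
    · exact Real.sqrt_nonneg _
    · exact le_rfl
  · set Vm : Matrix (Fin m) (Fin m) ℂ := Matrix.of fun i j => (b j).ofLp i with hVm
    have hVV : Vm * Vmᴴ = 1 := Matrix.mem_unitaryGroup_iff.1 (hunit b)
    rw [rectDiagonal_self, ← Matrix.mul_one A, ← hVV, ← Matrix.mul_assoc]
    congr 1
    ext i j
    rw [Matrix.mul_diagonal]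
    have := congrFun (hAw j) i
    simp only [Fin.is_lt, dif_pos, Fin.eta, Matrix.of_apply]
    rw [mul_comm]
    exact this

end Esprit

/-! ### Perturbation of the shift eigenvalues, and passage to angles. -/

namespace Esprit

open Finset
open scoped ComplexOrder Matrix Matrix.Norms.L2Operator

theorem l2norm_dropLastRow_sq {L S : ℕ} (A : Matrix (Fin (L + 1)) (Fin S) ℂ) (v : Fin S → ℂ) :
    l2norm (dropLastRow A *ᵥ v) ^ 2 + ‖(A *ᵥ v) (Fin.last L)‖ ^ 2 = l2norm (A *ᵥ v) ^ 2 := by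
  rw [l2norm_sq, l2norm_sq, Fin.sum_univ_castSucc]; rfl

theorem l2norm_dropFirstRow_sq {L S : ℕ} (A : Matrix (Fin (L + 1)) (Fin S) ℂ) (v : Fin S → ℂ) :
    ‖(A *ᵥ v) 0‖ ^ 2 + l2norm (dropFirstRow A *ᵥ v) ^ 2 = l2norm (A *ᵥ v) ^ 2 := by
  rw [l2norm_sq, l2norm_sq, Fin.sum_univ_succ]; rfl

theorem l2norm_dropLastRow_le {L S : ℕ} (A : Matrix (Fin (L + 1)) (Fin S) ℂ) (v : Fin S → ℂ) :
    l2norm (dropLastRow A *ᵥ v) ≤ l2norm (A *ᵥ v) :=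
  le_of_sq_le_sq (by rw [← l2norm_dropLastRow_sq A v]; linarith [sq_nonneg ‖(A *ᵥ v) (Fin.last L)‖])
    (l2norm_nonneg _)

theorem l2norm_dropFirstRow_le {L S : ℕ} (A : Matrix (Fin (L + 1)) (Fin S) ℂ) (v : Fin S → ℂ) :
    l2norm (dropFirstRow A *ᵥ v) ≤ l2norm (A *ᵥ v) :=
  le_of_sq_le_sq (by rw [← l2norm_dropFirstRow_sq A v]; linarith [sq_nonneg ‖(A *ᵥ v) 0‖])
    (l2norm_nonneg _)

/-- A full column rank `A` satisfies `A† A = 1`, and `A†` is bounded by the inverse of a lower bound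
for `A`. -/
theorem IsPinv.mul_eq_one {m n : ℕ} {A : Matrix (Fin m) (Fin n) ℂ} {B : Matrix (Fin n) (Fin m) ℂ}
    (h : IsPinv A B) {c : ℝ} (hc : 0 < c) (hA : ∀ v, c * l2norm v ≤ l2norm (A *ᵥ v)) :
    B * A = 1 := by
  refine Matrix.ext_iff_mulVec.2 fun v => ?_
  rw [← sub_eq_zero, ← Matrix.sub_mulVec]
  by_contra hne
  have h1 := hA ((B * A - 1) *ᵥ v)
  rw [Matrix.mulVec_mulVec, Matrix.mul_sub, ← Matrix.mul_assoc, h.mul_mul_left, Matrix.mul_one,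
    sub_self, Matrix.zero_mulVec] at h1
  have h2 := mul_pos hc (l2norm_pos hne)
  have h3 : l2norm (0 : Fin m → ℂ) = 0 := by simp [l2norm]
  linarith

/-- `A * B` is an orthogonal projection by the Penrose equations, hence a contraction. -/
theorem IsPinv.l2norm_mulVec_le {m n : ℕ} {A : Matrix (Fin m) (Fin n) ℂ}
    {B : Matrix (Fin n) (Fin m) ℂ} (h : IsPinv A B) {c : ℝ}
    (hA : ∀ v, c * l2norm v ≤ l2norm (A *ᵥ v)) (z : Fin m → ℂ) :
    c * l2norm (B *ᵥ z) ≤ l2norm z := by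
  refine (hA _).trans ?_
  rw [Matrix.mulVec_mulVec]
  refine l2norm_mulVec_le_of_projection h.left_hermitian ?_ z
  rw [← Matrix.mul_assoc, h.mul_mul_left]

section Perturbation

variable {L S : ℕ} {U Φ : Matrix (Fin (L + 1)) (Fin S) ℂ} {s q ρ : ℝ}

/-- Since `U` is an isometry, `Uᴴ * Φ` is as large as `Φ` minus the residual, which takes at most
`3/8` of the lower bound `s`. -/
theorem lower_bound_conjTranspose_mul (hU : Uᴴ * U = 1) (hs : 0 < s) (hq1 : q ≤ 1)
    (hΦ : ∀ v, s * l2norm v ≤ l2norm (Φ *ᵥ v))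
    (hR : ∀ v, l2norm ((Φ - U * (Uᴴ * Φ)) *ᵥ v) ≤ ρ * l2norm v) (hρ : ρ ≤ 3 / 8 * (s * q))
    (v : Fin S → ℂ) : 5 / 8 * s * l2norm v ≤ l2norm ((Uᴴ * Φ) *ᵥ v) := by
  have h1 : l2norm ((Uᴴ * Φ) *ᵥ v) = l2norm (Φ *ᵥ v - (Φ - U * (Uᴴ * Φ)) *ᵥ v) := by
    rw [← Matrix.sub_mulVec, sub_sub_cancel, ← Matrix.mulVec_mulVec _ U, l2norm_mulVec_eq hU]
  have h2 := l2norm_sub_le_l2norm_sub (Φ *ᵥ v) ((Φ - U * (Uᴴ * Φ)) *ᵥ v)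
  have h3 := hR v
  have h4 := hΦ v
  have h5 : ρ * l2norm v ≤ 3 / 8 * s * l2norm v :=
    mul_le_mul_of_nonneg_right (hρ.trans (by nlinarith)) (l2norm_nonneg v)
  rw [h1]
  linarith

theorem isUnit_det_of_lower_bound {n : ℕ} {P : Matrix (Fin n) (Fin n) ℂ} {c : ℝ} (hc : 0 < c)
    (hP : ∀ v, c * l2norm v ≤ l2norm (P *ᵥ v)) : IsUnit P.det := by
  rw [isUnit_iff_ne_zero, Ne, ← Matrix.exists_mulVec_eq_zero_iff]
  rintro ⟨v, hv, h⟩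
  have h1 := hP v
  rw [h] at h1
  have h2 := mul_pos hc (l2norm_pos hv)
  have h3 : l2norm (0 : Fin n → ℂ) = 0 := by simp [l2norm]
  linarith

/-- Write `w = (Uᴴ * Φ) v`. Then `U₀ w` is `Φ₀ v` minus a residual of size at most `3/8 * q * ‖Φ
v‖`, and `‖w‖ ≤ ‖Φ v‖`. -/
theorem lower_bound_dropLastRow (hU : Uᴴ * U = 1) (hs : 0 < s) (hq : 0 < q) (hq1 : q ≤ 1)
    (hΦ : ∀ v, s * l2norm v ≤ l2norm (Φ *ᵥ v))
    (hΦ0 : ∀ v, q * l2norm (Φ *ᵥ v) ≤ l2norm (dropLastRow Φ *ᵥ v))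
    (hR : ∀ v, l2norm ((Φ - U * (Uᴴ * Φ)) *ᵥ v) ≤ ρ * l2norm v) (hρ : ρ ≤ 3 / 8 * (s * q))
    (w : Fin S → ℂ) : 5 / 8 * q * l2norm w ≤ l2norm (dropLastRow U *ᵥ w) := by
  have hP := lower_bound_conjTranspose_mul hU hs hq1 hΦ hR hρ
  have hdet := isUnit_det_of_lower_bound (by positivity) hP
  set v := (Uᴴ * Φ)⁻¹ *ᵥ w with hv
  have hw : w = (Uᴴ * Φ) *ᵥ v := by
    rw [hv, Matrix.mulVec_mulVec, Matrix.mul_nonsing_inv _ hdet, Matrix.one_mulVec]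
  have hwle : l2norm w ≤ l2norm (Φ *ᵥ v) := by
    rw [hw, ← Matrix.mulVec_mulVec]
    have := l2norm_conjTranspose_mulVec_le (A := U) zero_le_one
      (fun v => by rw [one_mul, l2norm_mulVec_eq hU]) (Φ *ᵥ v)
    rwa [one_mul] at this
  have h0 : dropLastRow U *ᵥ w =
      dropLastRow Φ *ᵥ v - dropLastRow (Φ - U * (Uᴴ * Φ)) *ᵥ v := by
    have : dropLastRow (Φ - U * (Uᴴ * Φ)) = dropLastRow Φ - dropLastRow U * (Uᴴ * Φ) := rfl
    rw [this, ← Matrix.sub_mulVec, sub_sub_cancel, ← Matrix.mulVec_mulVec, ← hw]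
  have h1 := l2norm_sub_le_l2norm_sub (dropLastRow Φ *ᵥ v) (dropLastRow (Φ - U * (Uᴴ * Φ)) *ᵥ v)
  have h2 := (l2norm_dropLastRow_le _ _).trans (hR v)
  have h3 : ρ * l2norm v ≤ 3 / 8 * (s * q) * l2norm v :=
    mul_le_mul_of_nonneg_right hρ (l2norm_nonneg v)
  have h4 := mul_le_mul_of_nonneg_left (hΦ v) hq.le
  have h5 := hΦ0 v
  have h6 := mul_le_mul_of_nonneg_left hwle hq.le
  rw [h0]
  linarith

/-- Perturbation bound for the eigenvalues of `U₀† U₁`, when the range of `U` is close to that of a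
matrix `Φ` with `Φ₁ = Φ₀ diag(d)`. -/
theorem exists_perm_norm_eigenvalue_sub_le {d lam : Fin S → ℂ} {B : Matrix (Fin S) (Fin L) ℂ}
    (hU : Uᴴ * U = 1) (hs : 0 < s) (hq : 0 < q) (hq1 : q ≤ 1) (hd : ∀ j, ‖d j‖ = 1)
    (hshift : dropFirstRow Φ = dropLastRow Φ * Matrix.diagonal d)
    (hΦ : ∀ v, s * l2norm v ≤ l2norm (Φ *ᵥ v))
    (hΦ0 : ∀ v, q * l2norm (Φ *ᵥ v) ≤ l2norm (dropLastRow Φ *ᵥ v)) (hρ0 : 0 ≤ ρ)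
    (hR : ∀ v, l2norm ((Φ - U * (Uᴴ * Φ)) *ᵥ v) ≤ ρ * l2norm v) (hρ : ρ ≤ 3 / 8 * (s * q))
    (hB : IsPinv (dropLastRow U) B) (hlam : IsEigenvalueList (B * dropFirstRow U) lam) :
    ∃ ψ : Equiv.Perm (Fin S), ∀ j,
      ‖lam (ψ j) - d j‖ ≤ (2 * S - 1) * (128 / 25 * (ρ / (s * q))) := by
  have hP := lower_bound_conjTranspose_mul hU hs hq1 hΦ hR hρ
  have hdet := isUnit_det_of_lower_bound (by positivity) hP
  have hU0 := lower_bound_dropLastRow hU hs hq hq1 hΦ hΦ0 hR hρ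
  have hBU := hB.mul_eq_one (by positivity) hU0
  set P := Uᴴ * Φ with hPdef
  set R := Φ - U * P with hRdef
  set D := Matrix.diagonal d with hD
  -- From `U₁ P = Φ₁ - R₁ = U₀ P D + (R₀ D - R₁)` and `B U₀ = 1`, the matrix `B U₁` is conjugate by
  -- `P` to exactly `D + F`. The constant `128/25` below is `2 * (8/5)²`: two residuals and the
  -- inverse lower bounds for `P` and `U₀`.
  set F := P⁻¹ * (B * (dropLastRow R * D - dropFirstRow R)) with hF
  have hDn : ∀ v, l2norm (D *ᵥ v) ≤ l2norm v := fun v => by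
    rw [← one_mul (l2norm v)]
    refine l2norm_le_of_norm_le zero_le_one fun i => ?_
    rw [hD, Matrix.mulVec_diagonal, norm_mul, hd]
  have hFn : ∀ v, l2norm (F *ᵥ v) ≤ 128 / 25 * (ρ / (s * q)) * l2norm v := by
    intro v
    set y := (dropLastRow R * D - dropFirstRow R) *ᵥ v with hy
    have hFv : F *ᵥ v = P⁻¹ *ᵥ (B *ᵥ y) := by
      rw [hF, hy, Matrix.mulVec_mulVec, Matrix.mulVec_mulVec, Matrix.mul_assoc]
    have a1 : l2norm y ≤ 2 * ρ * l2norm v := by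
      rw [hy, Matrix.sub_mulVec, ← Matrix.mulVec_mulVec]
      refine (l2norm_sub_le _ _).trans ?_
      have b1 := (l2norm_dropLastRow_le R (D *ᵥ v)).trans (hR _)
      have b2 := (l2norm_dropFirstRow_le R v).trans (hR v)
      have b3 := mul_le_mul_of_nonneg_left (hDn v) hρ0
      linarith
    have a2 := hB.l2norm_mulVec_le hU0 y
    have a3 := hP (P⁻¹ *ᵥ (B *ᵥ y))
    rw [Matrix.mulVec_mulVec _ P, Matrix.mul_nonsing_inv _ hdet, Matrix.one_mulVec, ← hFv] at a3
    have a4 := mul_le_mul_of_nonneg_left a3 (by positivity : 0 ≤ 5 / 8 * q)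
    have a5 : 25 / 64 * (s * q) * l2norm (F *ᵥ v) ≤ 2 * ρ * l2norm v := by linarith
    have : 128 / 25 * (ρ / (s * q)) * l2norm v = 2 * ρ * l2norm v / (25 / 64 * (s * q)) := by
      field_simp; ring
    rw [this, le_div_iff₀ (by positivity)]
    linarith
  have hconj : D + F = P⁻¹ * (B * dropFirstRow U * P) := by
    have e1 : dropFirstRow U * P = dropFirstRow Φ - dropFirstRow R := by
      have : dropFirstRow R = dropFirstRow Φ - dropFirstRow U * P := rfl
      rw [this, sub_sub_cancel]
    have e2 : dropLastRow Φ = dropLastRow U * P + dropLastRow R := by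
      have : dropLastRow R = dropLastRow Φ - dropLastRow U * P := rfl
      rw [this, add_sub_cancel]
    have e3 : B * dropFirstRow U * P = P * D + B * (dropLastRow R * D - dropFirstRow R) := by
      rw [Matrix.mul_assoc, e1, hshift, e2, Matrix.add_mul, add_sub_assoc, Matrix.mul_add,
        ← Matrix.mul_assoc, ← Matrix.mul_assoc B, hBU, Matrix.one_mul]
    rw [e3, Matrix.mul_add, ← Matrix.mul_assoc P⁻¹ P D, Matrix.nonsing_inv_mul _ hdet,
      Matrix.one_mul]
  refine exists_perm_norm_sub_le (by positivity) hFn ?_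
  rw [hconj, Matrix.charpoly_mul_comm, Matrix.mul_assoc, Matrix.mul_nonsing_inv _ hdet,
    Matrix.mul_one]
  exact hlam

end Perturbation

/-! ### Angles -/

theorem norm_coe_le_abs (x : ℝ) : ‖(x : UnitAddCircle)‖ ≤ |x| := by
  rw [UnitAddCircle.norm_eq]
  simpa using round_le x 0

/-- Far from `1` the bound is trivial, as the circle has radius `1/2`. Near `1`, the distance from
`1` to the line through `0` and `u` is `|sin (arg u)|`, and Jordan's inequality recovers the
argument. -/
theorem abs_arg_div_le (u : ℂ) : ‖((u.arg / (2 * Real.pi) : ℝ) : UnitAddCircle)‖ ≤ ‖u - 1‖ / 2 := by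
  have hpi := Real.pi_pos
  by_cases h1 : 1 ≤ ‖u - 1‖
  · have := AddCircle.norm_le_half_period (1 : ℝ) (x := ((u.arg / (2 * Real.pi) : ℝ) : UnitAddCircle))
      one_ne_zero
    rw [abs_one] at this
    linarith
  · rw [not_le] at h1
    have hre : 0 < u.re := by
      have := (Complex.abs_re_le_norm (u - 1)).trans_lt h1
      rw [Complex.sub_re, Complex.one_re, abs_lt] at this
      linarith
    have harg : |u.arg| ≤ Real.pi / 2 := Complex.abs_arg_le_pi_div_two_iff.2 hre.le
    have hu0 : u ≠ 0 := fun h => by simp [h] at hre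
    have hsin : |Real.sin u.arg| ≤ ‖u - 1‖ := by
      have hpos : 0 < ‖u‖ := norm_pos_iff.2 hu0
      rw [Complex.sin_arg, abs_div, abs_of_pos hpos, div_le_iff₀ hpos]
      refine abs_le_of_sq_le_sq ?_ (by positivity)
      rw [mul_pow, ← Complex.normSq_eq_norm_sq, ← Complex.normSq_eq_norm_sq, Complex.normSq_apply,
        Complex.normSq_apply]
      simp only [Complex.sub_re, Complex.sub_im, Complex.one_re, Complex.one_im, sub_zero]
      nlinarith [sq_nonneg (u.re * u.re + u.im * u.im - u.re)]
    have hle : 2 / Real.pi * |u.arg| ≤ |Real.sin u.arg| := Real.mul_abs_le_abs_sin harg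
    refine (norm_coe_le_abs _).trans ?_
    rw [abs_div, abs_of_pos (by positivity : 0 < 2 * Real.pi), div_le_iff₀ (by positivity)]
    have h3 : 2 * |u.arg| ≤ Real.pi * ‖u - 1‖ := by
      have := hle.trans hsin
      rw [div_mul_eq_mul_div, div_le_iff₀ hpi] at this
      linarith
    nlinarith [abs_nonneg u.arg]

theorem dist_neg_arg_le (z : ℂ) (w : ℝ) :
    dist ((-z.arg / (2 * Real.pi) : ℝ) : UnitAddCircle) (w : UnitAddCircle) ≤
      ‖z - cexpTwoPi (-w)‖ / 2 := by
  have hpi := Real.pi_pos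
  set u := z * cexpTwoPi w with hu
  have hinv : cexpTwoPi w * cexpTwoPi (-w) = 1 := by
    rw [← cexpTwoPi_add]; simp [cexpTwoPi]
  have h1 : ‖u - 1‖ = ‖z - cexpTwoPi (-w)‖ := by
    rw [hu, ← hinv, mul_comm z, ← mul_sub, norm_mul, norm_cexpTwoPi, one_mul]
  rw [← h1]
  -- At `z = 0` the argument takes its default value, and the right side is `1/2`, the largest
  -- distance on the circle.
  rcases eq_or_ne z 0 with rfl | hz
  · have hh := AddCircle.norm_le_half_period (1 : ℝ)
      (x := ((-(0 : ℂ).arg / (2 * Real.pi) : ℝ) : UnitAddCircle) - (w : UnitAddCircle)) one_ne_zero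
    rw [abs_one] at hh
    rw [dist_eq_norm, hu, zero_mul, zero_sub, norm_neg, norm_one]
    exact hh
  refine le_of_eq_of_le ?_ (abs_arg_div_le u)
  rw [dist_eq_norm, ← norm_neg, neg_sub, ← AddCircle.coe_sub]
  congr 1
  rw [← sub_eq_zero, ← AddCircle.coe_sub, AddCircle.coe_eq_zero_iff]
  have hang : (u.arg : Real.Angle) = ((z.arg + 2 * Real.pi * w : ℝ) : Real.Angle) := by
    have hc : cexpTwoPi w ≠ 0 := fun h => by
      have := norm_cexpTwoPi w; rw [h, norm_zero] at this; exact zero_ne_one this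
    rw [hu, Complex.arg_mul_coe_angle hz hc, Real.Angle.coe_add]
    congr 1
    rw [cexpTwoPi, show 2 * (Real.pi : ℂ) * Complex.I * w = ((2 * Real.pi * w : ℝ) : ℂ) * Complex.I by
      push_cast; ring, Complex.exp_mul_I, ← Complex.ofReal_cos, ← Complex.ofReal_sin]
    exact Complex.arg_cos_add_sin_mul_I_coe_angle ((2 * Real.pi * w : ℝ) : Real.Angle)
  obtain ⟨n, hn⟩ := Real.Angle.angle_eq_iff_two_pi_dvd_sub.1 hang
  refine ⟨-n, ?_⟩
  rw [zsmul_eq_mul, mul_one, Int.cast_neg]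
  field_simp
  linarith

end Esprit

/-! ### Vandermonde matrices and the bound for ESPRIT. -/

namespace Esprit

open Finset
open scoped ComplexOrder Matrix Matrix.Norms.L2Operator

/-- The nonharmonic Fourier (Vandermonde) matrix with `N` rows and nodes `w`. -/
def vander (N : ℕ) {S : ℕ} (w : Fin S → ℝ) : Matrix (Fin N) (Fin S) ℂ :=
  Matrix.of fun k j => cexpTwoPi (-(k * w j))

theorem fourier_neg_coe (k : ℕ) (w : ℝ) :
    fourier (-(k : ℤ)) (w : UnitAddCircle) = cexpTwoPi (-(k * w)) := by
  rw [fourier_coe_apply, cexpTwoPi]; congr 1; push_cast; ring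

theorem hankel_add {M L : ℕ} (hLM : L ≤ M) (y z : Fin (M + 1) → ℂ) :
    hankel hLM (y + z) = hankel hLM y + hankel hLM z := rfl

theorem hankel_fourierData {M L S : ℕ} (hLM : L ≤ M) (x : Fin S → ℂ) (w : Fin S → ℝ) :
    hankel hLM (fourierData M x fun j => (w j : UnitAddCircle)) =
      vander (L + 1) w * (Matrix.diagonal x * (vander (M - L + 1) w)ᵀ) := by
  ext i k
  rw [Matrix.mul_apply, hankel, Matrix.of_apply, fourierData]
  refine sum_congr rfl fun j _ => ?_
  rw [Matrix.diagonal_mul, Matrix.transpose_apply, vander, vander, Matrix.of_apply,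
    Matrix.of_apply, fourier_neg_coe]
  rw [show -(((i : ℕ) + (k : ℕ) : ℕ) * w j) = -((i : ℕ) * w j) + -((k : ℕ) * w j) by
    push_cast; ring, cexpTwoPi_add]
  ring

theorem dropFirstRow_vander (L : ℕ) {S : ℕ} (w : Fin S → ℝ) :
    dropFirstRow (vander (L + 1) w) =
      dropLastRow (vander (L + 1) w) * Matrix.diagonal fun j => cexpTwoPi (-w j) := by
  ext i j
  rw [Matrix.mul_diagonal]
  simp only [dropFirstRow, dropLastRow, vander, Matrix.submatrix_apply, Matrix.of_apply, id]
  rw [← cexpTwoPi_add]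
  congr 1
  rw [Fin.val_succ, Fin.val_castSucc]; push_cast; ring

theorem conjTranspose_transpose_vander (N : ℕ) {S : ℕ} (w : Fin S → ℝ) :
    ((vander N w)ᵀ)ᴴ = vander N (-w) := by
  ext i j
  rw [Matrix.conjTranspose_apply, Matrix.transpose_apply, vander, vander, Matrix.of_apply,
    Matrix.of_apply, RCLike.star_def, conj_cexpTwoPi]
  congr 1; simp

theorem Separated.neg {ι : Type*} {δ : ℝ} {w : ι → ℝ} (hw : Separated δ w) :
    Separated δ (-w) := fun r s hrs => by
  have := hw s r hrs.symm
  rwa [show (-w) r - (-w) s = w s - w r by simp; ring]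

theorem Separated.le_l2norm_vander {S : ℕ} {δ : ℝ} {w : Fin S → ℝ} (hδ : 0 < δ)
    (hw : Separated δ w) (N : ℕ) {s : ℝ} (hsN : s ^ 2 ≤ N - δ⁻¹) (v : Fin S → ℂ) :
    s * l2norm v ≤ l2norm (vander N w *ᵥ v) := by
  refine le_of_sq_le_sq ?_ (l2norm_nonneg _)
  have h := hw.abs_sum_norm_sq_sub_le hδ N v
  have h1 : l2norm (vander N w *ᵥ v) ^ 2 =
      ∑ k ∈ range N, ‖∑ j, cexpTwoPi (-(k * w j)) * v j‖ ^ 2 := by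
    rw [l2norm_sq, ← Fin.sum_univ_eq_sum_range (fun k => ‖∑ j, cexpTwoPi (-(k * w j)) * v j‖ ^ 2)]
    rfl
  rw [← h1, ← l2norm_sq] at h
  have h2 := (abs_le.1 h).1
  have h3 := mul_le_mul_of_nonneg_right hsN (sq_nonneg (l2norm v))
  rw [mul_pow]
  linarith

theorem norm_vander_mulVec_sq_le {N S : ℕ} (w : Fin S → ℝ) (v : Fin S → ℂ) (k : Fin N) :
    ‖(vander N w *ᵥ v) k‖ ^ 2 ≤ S * l2norm v ^ 2 := by
  have h1 : ‖(vander N w *ᵥ v) k‖ ≤ ∑ j, ‖v j‖ := by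
    rw [Matrix.mulVec, dotProduct]
    refine (norm_sum_le _ _).trans_eq (sum_congr rfl fun j _ => ?_)
    rw [norm_mul, vander, Matrix.of_apply, norm_cexpTwoPi, one_mul]
  have h2 := sq_sum_le_card_mul_sum_sq (s := (univ : Finset (Fin S))) (f := fun j => ‖v j‖)
  rw [card_univ, Fintype.card_fin] at h2
  rw [l2norm_sq]
  exact (pow_le_pow_left₀ (norm_nonneg _) h1 2).trans h2

/-- The deleted entry has square at most `S ‖v‖²`, by Cauchy–Schwarz with unimodular coefficients,
and `‖v‖` is controlled by `‖Φ v‖ / s`. -/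
theorem le_l2norm_dropLastRow_vander {L S : ℕ} {w : Fin S → ℝ} {s q : ℝ} (hs : 0 < s)
    (hqs : q ^ 2 = 1 - S / s ^ 2) (h : ∀ v, s * l2norm v ≤ l2norm (vander (L + 1) w *ᵥ v))
    (v : Fin S → ℂ) :
    q * l2norm (vander (L + 1) w *ᵥ v) ≤ l2norm (dropLastRow (vander (L + 1) w) *ᵥ v) := by
  refine le_of_sq_le_sq ?_ (l2norm_nonneg _)
  have h1 := l2norm_dropLastRow_sq (vander (L + 1) w) v
  have h2 := norm_vander_mulVec_sq_le w v (Fin.last L)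
  have h3 := pow_le_pow_left₀ (mul_nonneg hs.le (l2norm_nonneg v)) (h v) 2
  have h4 : (S : ℝ) * l2norm v ^ 2 ≤ S / s ^ 2 * l2norm (vander (L + 1) w *ᵥ v) ^ 2 := by
    rw [div_mul_eq_mul_div, le_div_iff₀ (by positivity)]
    nlinarith [(Nat.cast_nonneg S : (0 : ℝ) ≤ S)]
  rw [mul_pow, hqs]
  linarith

/-- Cancels the right factor `T`: in the adjoint `Tᴴ * Rᴴ` it acts last, so its lower bound applies
directly. -/
theorem l2norm_mulVec_le_of_mul {m n k : ℕ} {R : Matrix (Fin m) (Fin k) ℂ}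
    {T : Matrix (Fin k) (Fin n) ℂ} {a τ : ℝ} (ha : 0 ≤ a) (hτ : 0 < τ)
    (hRT : ∀ v, l2norm ((R * T) *ᵥ v) ≤ a * l2norm v)
    (hT : ∀ z, τ * l2norm z ≤ l2norm (Tᴴ *ᵥ z)) (v : Fin k → ℂ) :
    l2norm (R *ᵥ v) ≤ a / τ * l2norm v := by
  rw [← Matrix.conjTranspose_conjTranspose R]
  refine l2norm_conjTranspose_mulVec_le (by positivity) (fun x => ?_) v
  have h1 := l2norm_conjTranspose_mulVec_le ha hRT x
  rw [Matrix.conjTranspose_mul, ← Matrix.mulVec_mulVec] at h1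
  have h2 := hT (Rᴴ *ᵥ x)
  rw [div_mul_eq_mul_div, le_div_iff₀ hτ]
  linarith

theorem ampMin_pos {S : ℕ} (hS : 0 < S) {x : Fin S → ℂ} (hx : ∀ j, x j ≠ 0) : 0 < ampMin x := by
  have : Nonempty (Fin S) := ⟨⟨0, hS⟩⟩
  obtain ⟨j, hj⟩ := exists_eq_ciInf_of_finite (f := fun j => ‖x j‖)
  rw [ampMin, ← hj]
  exact norm_pos_iff.2 (hx j)

theorem ampMin_le {S : ℕ} (x : Fin S → ℂ) (j : Fin S) : ampMin x ≤ ‖x j‖ :=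
  ciInf_le (Set.finite_range _).bddBelow j

theorem Separated.le_l2norm_conjTranspose_diagonal_mul {S N : ℕ} {δ : ℝ} {w : Fin S → ℝ}
    (hδ : 0 < δ) (hw : Separated δ w) {x : Fin S → ℂ} (hx : 0 ≤ ampMin x) {s : ℝ} (hs : 0 ≤ s)
    (hsN : s ^ 2 ≤ N - δ⁻¹) (z : Fin S → ℂ) :
    ampMin x * s * l2norm z ≤ l2norm ((Matrix.diagonal x * (vander N w)ᵀ)ᴴ *ᵥ z) := by
  rw [Matrix.conjTranspose_mul, conjTranspose_transpose_vander, ← Matrix.mulVec_mulVec,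
    Matrix.diagonal_conjTranspose]
  have h1 := hw.neg.le_l2norm_vander hδ N hsN (Matrix.diagonal (star x) *ᵥ z)
  have h2 : ampMin x * l2norm z ≤ l2norm (Matrix.diagonal (star x) *ᵥ z) := by
    refine le_of_sq_le_sq ?_ (l2norm_nonneg _)
    rw [mul_pow, l2norm_sq, l2norm_sq, mul_sum]
    refine sum_le_sum fun j _ => ?_
    rw [Matrix.mulVec_diagonal, norm_mul, Pi.star_apply, norm_star, mul_pow]
    have := ampMin_le x j
    gcongr
  have h3 := mul_le_mul_of_nonneg_left h2 hs
  linarith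

theorem matchingDist_le {S : ℕ} (hS : 0 < S) {ω ωhat : Fin S → UnitAddCircle} {r : ℝ}
    (ψ : Equiv.Perm (Fin S)) (h : ∀ j, dist (ωhat (ψ j)) (ω j) ≤ r) :
    matchingDist ω ωhat ≤ r := by
  have : Nonempty (Fin S) := ⟨⟨0, hS⟩⟩
  exact (ciInf_le (Set.finite_range _).bddBelow ψ).trans (ciSup_le h)

theorem separated_of_le_minSep {S : ℕ} {ω : Fin S → UnitAddCircle} {δ : ℝ}
    (h : ENNReal.ofReal δ ≤ minSep ω) {w : Fin S → ℝ} (hw : ∀ j, (w j : UnitAddCircle) = ω j) :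
    Separated δ w := fun j k hjk => by
  have h1 : ENNReal.ofReal δ ≤ edist (ω j) (ω k) :=
    h.trans (iInf_le_of_le j (iInf_le_of_le k (iInf_le _ hjk)))
  rw [edist_dist, ENNReal.ofReal_le_ofReal_iff dist_nonneg, dist_eq_norm, ← hw, ← hw,
    ← AddCircle.coe_sub] at h1
  exact h1

/-- ESPRIT on noisy data: existence of an output and the basic matching bound, in terms of a lower
bound `s` for the singular values of the Vandermonde matrices. -/
theorem exists_isOutput_and_matchingDist_le {M L S : ℕ} (hS : 0 < S) (hM : M = L + L)
    (hSL : S ≤ L) (hLM : L ≤ M) {x : Fin S → ℂ} (hx : ∀ j, x j ≠ 0) {ω : Fin S → UnitAddCircle}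
    {δ s q : ℝ} (hδ : 0 < δ) (hsep : ENNReal.ofReal δ ≤ minSep ω) (hs : 0 < s)
    (hsL : s ^ 2 ≤ L + 1 - δ⁻¹) (hq : 0 < q) (hqs : q ^ 2 = 1 - S / s ^ 2)
    {η : Fin (M + 1) → ℂ} (hη : spectralNorm (hankel hLM η) ≤ 3 / 16 * (ampMin x * s ^ 2 * q)) :
    (∃ ωhat, IsOutput hSL hLM (fourierData M x ω + η) ωhat) ∧
      ∀ ωhat, IsOutput hSL hLM (fourierData M x ω + η) ωhat →
        matchingDist ω ωhat ≤ (2 * S - 1) *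
          (128 / 25 * (spectralNorm (hankel hLM η) / (ampMin x * s ^ 2 * q))) := by
  choose w hw using fun j => QuotientAddGroup.mk_surjective (ω j)
  have hwω : (fun j => (w j : UnitAddCircle)) = ω := funext hw
  have hsep' := separated_of_le_minSep hsep hw
  have hxm := ampMin_pos hS hx
  set ε := spectralNorm (hankel hLM η) with hε
  have hε0 : 0 ≤ ε := norm_nonneg (hankel hLM η)
  have hq1 : q ≤ 1 := by
    have : 0 ≤ (S : ℝ) / s ^ 2 := by positivity
    nlinarith
  set Φ := vander (L + 1) w with hΦdef
  set T := Matrix.diagonal x * (vander (M - L + 1) w)ᵀ with hT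
  have hH : hankel hLM (fourierData M x ω + η) = Φ * T + hankel hLM η := by
    rw [hankel_add, ← hwω, hankel_fourierData]
  have hΦ : ∀ v, s * l2norm v ≤ l2norm (Φ *ᵥ v) :=
    hsep'.le_l2norm_vander hδ (L + 1) (by push_cast; exact hsL)
  have hΦ0 := le_l2norm_dropLastRow_vander hs hqs hΦ
  have hTlow := hsep'.le_l2norm_conjTranspose_diagonal_mul (N := M - L + 1) hδ hxm.le hs.le (by
    rw [show M - L + 1 = L + 1 by omega]; push_cast; exact hsL)
  have hmn : L + 1 = M - L + 1 := by omega
  -- The residual `2ε` of `Φ T`, divided by the lower bound `ampMin x * s` for `Tᴴ`. The noise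
  -- hypothesis is exactly `ρ ≤ 3/8 * (s * q)`.
  set ρ := 2 * ε / (ampMin x * s) with hρdef
  have hρ0 : 0 ≤ ρ := by positivity
  have hρ : ρ ≤ 3 / 8 * (s * q) := by
    rw [hρdef, div_le_iff₀ (by positivity)]
    linarith
  have hRU : ∀ {W σ V}, IsSVD (hankel hLM (fourierData M x ω + η)) W σ V → ∀ v,
      l2norm ((Φ - firstCols (Nat.le_succ_of_le hSL) W *
        ((firstCols (Nat.le_succ_of_le hSL) W)ᴴ * Φ)) *ᵥ v) ≤ ρ * l2norm v := by
    intro W σ V h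
    refine l2norm_mulVec_le_of_mul (by positivity) (by positivity) (fun v => ?_) hTlow
    have := h.l2norm_sub_firstCols_mulVec_le hmn (Nat.lt_succ_of_le hSL) (P := Φ) (Q := T) (ε := ε)
      (fun v => by
        rw [hH, add_sub_cancel_left]
        exact l2norm_mulVec_le _ _) v
    rw [Matrix.sub_mul, Matrix.mul_assoc _ _ T, Matrix.mul_assoc _ Φ T, Matrix.sub_mulVec,
      ← Matrix.mulVec_mulVec _ (firstCols _ W), ← Matrix.mulVec_mulVec _ (firstCols _ W)ᴴ]
    exact this
  have hUU : ∀ {W σ V}, IsSVD (hankel hLM (fourierData M x ω + η)) W σ V →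
      (firstCols (Nat.le_succ_of_le hSL) W)ᴴ * firstCols (Nat.le_succ_of_le hSL) W = 1 :=
    fun h => conjTranspose_firstCols_mul _ h.left_unitary
  constructor
  · obtain ⟨W, σ, V, h⟩ := exists_isSVD_of_eq hmn (hankel hLM (fourierData M x ω + η))
    have hlow := lower_bound_dropLastRow (hUU h) hs hq hq1 hΦ hΦ0 (hRU h) hρ
    obtain ⟨B, hB⟩ := exists_isPinv (A := dropLastRow (firstCols (Nat.le_succ_of_le hSL) W))
      fun v hv => by
        by_contra hne
        have h1 := hlow v
        rw [hv] at h1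
        have h2 := mul_pos (by positivity : 0 < 5 / 8 * q) (l2norm_pos hne)
        have h3 : l2norm (0 : Fin L → ℂ) = 0 := by simp [l2norm]
        linarith
    obtain ⟨lam, hlam⟩ := exists_charpoly_eq_prod
      (B * dropFirstRow (firstCols (Nat.le_succ_of_le hSL) W))
    exact ⟨_, W, σ, V, B, lam, h, hB, hlam, fun j => rfl⟩
  · rintro ωhat ⟨W, σ, V, B, lam, h, hB, hlam, hωhat⟩
    obtain ⟨ψ, hψ⟩ := exists_perm_norm_eigenvalue_sub_le (hUU h) hs hq hq1
      (fun j => norm_cexpTwoPi (-w j)) (dropFirstRow_vander L w) hΦ hΦ0 hρ0 (hRU h) hρ hB hlam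
    refine matchingDist_le hS ψ fun j => ?_
    rw [hωhat, ← hw j]
    refine (dist_neg_arg_le _ _).trans ?_
    have h1 := hψ j
    -- The factor `2` in `ρ` cancels the `1/2` gained in passing to angles.
    have h2 : ρ / (s * q) = 2 * (ε / (ampMin x * s ^ 2 * q)) := by
      rw [hρdef]; field_simp
    rw [h2] at h1
    linarith

theorem rpow_three_halves {t : ℝ} (ht : 0 ≤ t) : t ^ (3 / 2 : ℝ) = t * √t := by
  rw [show (3 / 2 : ℝ) = 1 + 1 / 2 by norm_num, Real.rpow_add_of_nonneg ht (by norm_num)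
    (by norm_num), Real.rpow_one, Real.sqrt_eq_rpow]

end Esprit

end

/-! ### Choice of parameters and the final constants. -/

theorem theorem4p3 :
    ∃ K : ℕ → ℝ → ℝ → ℝ,
      ∀ (M S L : ℕ) (_ : 0 < S) (_ : Even M) (hMS : 4 * S ≤ M) (hL : L = M / 2)
        (x : Fin S → ℂ) (ω : Fin S → UnitAddCircle) (_ : ∀ j, x j ≠ 0)
        (C : ℝ) (_ : 2 < C) (_ : ENNReal.ofReal (C / L) ≤ Esprit.minSep ω)
        (hSL : S ≤ L) (hLM : L ≤ M) (η : Fin (M + 1) → ℂ)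
        (_ : Esprit.spectralNorm (Esprit.hankel hLM η) ≤
          Esprit.ampMin x * L / (4 * √(2 * S)) * ((C - 1) / C) *
            √(1 - C / (C - 1) * (S / L))),
        (∃ ωhat : Fin S → UnitAddCircle,
          Esprit.IsOutput hSL hLM (Esprit.fourierData M x ω + η) ωhat) ∧
        ∀ ωhat : Fin S → UnitAddCircle,
          Esprit.IsOutput hSL hLM (Esprit.fourierData M x ω + η) ωhat →
          Esprit.matchingDist ω ωhat ≤
              20 * (S : ℝ) ^ 2 / Esprit.ampMin x *
                (√((L : ℝ) + 1) / (L : ℝ) ^ (3 / 2 : ℝ)) * (C / (C - 1)) ^ (3 / 2 : ℝ) *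
                (1 - C / (C - 1) * (S / L))⁻¹ *
                Esprit.spectralNorm (Esprit.hankel hLM η) ∧
            Esprit.matchingDist ω ωhat ≤
              K S C (Esprit.ampMin x) * Esprit.spectralNorm (Esprit.hankel hLM η) / M := by

  -- The `4` comes from `√(L+1) / L^(3/2) ≤ 4 / M`; the last factor bounds the inverse of `1 -
  -- C/(C-1) * (S/L)`, using `S/L ≤ 1/2` and `C > 2`.
  refine ⟨fun S C a => 20 * (S : ℝ) ^ 2 / a * 4 * (C / (C - 1)) ^ (3 / 2 : ℝ) *
    (2 * (C - 1) / (C - 2)), ?_⟩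
  intro M S L hS hM hMS hL x ω hx C hC hsep hSL hLM η hη
  have hML : M = L + L := by
    obtain ⟨k, rfl⟩ := hM
    omega
  have hxm := Esprit.ampMin_pos hS hx
  have hS1 : (1 : ℝ) ≤ S := by exact_mod_cast hS
  have hL2 : 2 * (S : ℝ) ≤ L := by
    have : 2 * S ≤ L := by omega
    exact_mod_cast this
  have hLpos : (0 : ℝ) < L := by linarith
  have hC1 : 0 < C - 1 := by linarith
  have hC2 : 0 < C - 2 := by linarith
  have hC0 : 0 < C := by linarith
  set ε := Esprit.spectralNorm (Esprit.hankel hLM η) with hε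
  have hε0 : 0 ≤ ε := by
    open scoped Matrix.Norms.L2Operator in exact norm_nonneg (Esprit.hankel hLM η)
  set a := C / (C - 1) with ha
  have ha1 : 1 ≤ a := (one_le_div hC1).2 (by linarith)
  have hapos : 0 < a := by linarith
  have hSLhalf : (S : ℝ) / L ≤ 1 / 2 := by
    rw [div_le_iff₀ hLpos]; linarith
  have hqlow : (C - 2) / (2 * (C - 1)) ≤ 1 - a * (S / L) := by
    have h1 : a * (S / L) ≤ a * (1 / 2) := mul_le_mul_of_nonneg_left hSLhalf hapos.le
    have h2 : (C - 2) / (2 * (C - 1)) = 1 - a * (1 / 2) := by rw [ha]; field_simp; ring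
    linarith
  have hQpos : 0 < 1 - a * (S / L) := lt_of_lt_of_le (by positivity) hqlow
  -- With `δ = C / L` one has `L / a = L - δ⁻¹`, slightly below the large sieve bound `L + 1 - δ⁻¹`;
  -- this makes `1 - S / s²` equal to `q²`.
  set s := √(L / a) with hs
  set q := √(1 - a * (S / L)) with hq
  have hs2 : s ^ 2 = L / a := Real.sq_sqrt (by positivity)
  have hq2 : q ^ 2 = 1 - a * (S / L) := Real.sq_sqrt hQpos.le
  have hspos : 0 < s := Real.sqrt_pos.2 (by positivity)
  have hqpos : 0 < q := Real.sqrt_pos.2 hQpos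
  have hq1 : q ≤ 1 := by
    have : 0 ≤ a * (S / L) := by positivity
    nlinarith
  have hηs : ε ≤ 3 / 16 * (Esprit.ampMin x * s ^ 2 * q) := by
    refine hη.trans ?_
    -- Exactly what `1 / (4√(2S)) ≤ 3/16` requires.
    have h1 : 4 / 3 ≤ √(2 * (S : ℝ)) := Real.le_sqrt_of_sq_le (by linarith)
    have h2 : Esprit.ampMin x * L / (4 * √(2 * S)) * ((C - 1) / C) * q =
        Esprit.ampMin x * s ^ 2 * q / (4 * √(2 * S)) := by
      rw [hs2, ha]; field_simp
    rw [h2, div_le_iff₀ (by positivity)]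
    have h3 : 0 ≤ Esprit.ampMin x * s ^ 2 * q := by positivity
    nlinarith
  obtain ⟨hex, hbound⟩ := Esprit.exists_isOutput_and_matchingDist_le hS hML hSL hLM hx
    (δ := C / L) (s := s) (q := q) (by positivity) hsep hspos
    (by
      rw [hs2, ha, inv_div]
      have : (L : ℝ) / (C / (C - 1)) = L - L / C := by field_simp
      linarith) hqpos (by rw [hq2, hs2]; field_simp) hηs
  refine ⟨hex, fun ωhat hω => ?_⟩
  rw [Esprit.rpow_three_halves hLpos.le, Esprit.rpow_three_halves hapos.le]
  have hmain : Esprit.matchingDist ω ωhat ≤ 20 * (S : ℝ) ^ 2 / Esprit.ampMin x *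
      (√((L : ℝ) + 1) / (L * √L)) * (a * √a) * (1 - a * (S / L))⁻¹ * ε := by
    refine (hbound ωhat hω).trans ?_
    have hsa : 1 ≤ √a := Real.one_le_sqrt.2 ha1
    have hsL : 0 < √(L : ℝ) := Real.sqrt_pos.2 hLpos
    -- The argument gives the stronger factors `a / L` and `1 / q`; they are relaxed here and in
    -- `h2` to the stated powers.
    have h1 : 1 / s ^ 2 ≤ √((L : ℝ) + 1) / (L * √L) * (a * √a) := by
      have e1 : √(L : ℝ) ≤ √((L : ℝ) + 1) := Real.sqrt_le_sqrt (by linarith)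
      have e2 : 1 / s ^ 2 = √L / (L * √L) * (a * 1) := by rw [hs2]; field_simp
      rw [e2]
      gcongr
    have h2 : 1 / q ≤ (1 - a * (S / L))⁻¹ := by
      rw [← hq2, ← one_div]
      exact one_div_le_one_div_of_le (by positivity) (by nlinarith)
    have h3 : (2 * (S : ℝ) - 1) * (128 / 25) ≤ 20 * (S : ℝ) ^ 2 := by nlinarith
    calc (2 * (S : ℝ) - 1) * (128 / 25 * (ε / (Esprit.ampMin x * s ^ 2 * q)))
        = ((2 * (S : ℝ) - 1) * (128 / 25)) / Esprit.ampMin x * (1 / s ^ 2) * (1 / q) * ε := by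
          field_simp
      _ ≤ 20 * (S : ℝ) ^ 2 / Esprit.ampMin x * (√((L : ℝ) + 1) / (L * √L) * (a * √a)) *
          (1 - a * (S / L))⁻¹ * ε := by gcongr
      _ = _ := by ring
  refine ⟨hmain, hmain.trans ?_⟩
  have hMR : (M : ℝ) = 2 * L := by rw [hML]; push_cast; ring
  have h1 : √((L : ℝ) + 1) / (L * √L) ≤ 4 / M := by
    have hsL : 0 < √(L : ℝ) := Real.sqrt_pos.2 hLpos
    have e1 : √((L : ℝ) + 1) ≤ 2 * √L := by
      rw [← Real.sqrt_sq (zero_le_two : (0 : ℝ) ≤ 2), ← Real.sqrt_mul (by positivity)]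
      exact Real.sqrt_le_sqrt (by linarith)
    rw [hMR, div_le_div_iff₀ (by positivity) (by positivity)]
    nlinarith
  have h2 : (1 - a * (S / L))⁻¹ ≤ 2 * (C - 1) / (C - 2) := by
    rw [← inv_div (C - 2)]
    exact inv_anti₀ (by positivity) hqlow
  calc 20 * (S : ℝ) ^ 2 / Esprit.ampMin x * (√((L : ℝ) + 1) / (L * √L)) * (a * √a) *
        (1 - a * (S / L))⁻¹ * ε
      ≤ 20 * (S : ℝ) ^ 2 / Esprit.ampMin x * (4 / M) * (a * √a) *
        (2 * (C - 1) / (C - 2)) * ε := by gcongr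
    _ = _ := by dsimp only; rw [← ha, Esprit.rpow_three_halves hapos.le]; ring
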